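/- Consider a single seller with a finite set $W$ of $k$ water units, all of the same value, and a finite set $B$ of buyers, where buyer $b\in B$ requires $\gamma_b\ge 1$ units, together with a bipartite compatibility graph $G_w(W,B,E_w)$. A trading assignment is a set $\mathcal{T}\subseteq E_w$ of pairs $(w,b)$ such that every unit $w$ occurs in at most one pair and every buyer $b$ occurs in $\eta_b(\mathcal{T})\le\gamma_b$ pairs; its buyer satisfaction vector is $\psi(\mathcal{T})=(\eta_b(\mathcal{T})/\gamma_b)_{b\in B}$. For real vectors $\mu_1,\mu_2$ of equal length $n$, $\mu_1$ is leximin larger than $\mu_2$ if for some $0\le\ell<n$ the $\ell$ smallest entries of the two vectors, in sorted order, agree and the $(\ell+1)$-st smallest entry of $\mu_1$ is greater than that of $\mu_2$. There is an algorithm (a program of a random access machine with logarithmic cost) that, given any such instance with requirements written in binary, finds in time polynomial in the size of the instance (the number of units, of buyers and of unit--buyer pairs, plus the total binary length of the requirements) a trading assignment $\mathcal{T}^*$ whose buyer satisfaction vector is leximin-largest: for every trading assignment $\mathcal{T}$, either $\psi(\mathcal{T}^*)$ is leximin larger than $\psi(\mathcal{T})$, or the two vectors have the same entries up to order. -/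

import Mathlib

/-! ## Machine model: random access machines with logarithmic cost

A program is a fixed finite text of a while-language over a memory of arrays of natural numbers.
Array names are constants of the program, so that one program uses finitely many arrays; indices
are computed. Running time is charged by the logarithmic cost criterion: an operation costs one
plus the binary lengths of the numbers and addresses it handles. -/

namespace Ram

/-- A memory: `s a i` is the content of cell `i` of array `a`. -/
abbrev Memory : Type := ℕ → ℕ → ℕ

/-- Arithmetic expressions. -/
inductive Expr : Type
  | const (n : ℕ)
  | get (a : ℕ) (i : Expr)
  | add (e f : Expr)
  | sub (e f : Expr)
  | mul (e f : Expr)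

/-- The value of an expression (`sub` is truncated subtraction). -/
def Expr.eval (s : Memory) : Expr → ℕ
  | .const n => n
  | .get a i => s a (i.eval s)
  | .add e f => e.eval s + f.eval s
  | .sub e f => e.eval s - f.eval s
  | .mul e f => e.eval s * f.eval s

/-- The logarithmic cost of evaluating an expression; `Nat.size` is the binary length. -/
def Expr.cost (s : Memory) : Expr → ℕ
  | .const n => Nat.size n + 1
  | .get a i => i.cost s + Nat.size (i.eval s) + Nat.size (s a (i.eval s)) + 1
  | .add e f => e.cost s + f.cost s + Nat.size (e.eval s) + Nat.size (f.eval s) + 1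
  | .sub e f => e.cost s + f.cost s + Nat.size (e.eval s) + Nat.size (f.eval s) + 1
  | .mul e f => e.cost s + f.cost s + Nat.size (e.eval s) + Nat.size (f.eval s) + 1

/-- Programs. A number counts as true when it is not zero. -/
inductive Program : Type
  | skip
  | assign (a : ℕ) (i e : Expr)
  | seq (c d : Program)
  | cond (e : Expr) (c d : Program)
  | loop (e : Expr) (c : Program)

/-- The memory after writing `v` into cell `i` of array `a`. -/
def Memory.write (s : Memory) (a i v : ℕ) : Memory :=
  fun a' i' => if a' = a ∧ i' = i then v else s a' i'

/-- `Run c s t s'`: started in memory `s`, program `c` halts in memory `s'` after time `t`. -/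
inductive Run : Program → Memory → ℕ → Memory → Prop
  | skip (s : Memory) : Run .skip s 1 s
  | assign (s : Memory) (a : ℕ) (i e : Expr) :
      Run (.assign a i e) s
        (i.cost s + e.cost s + Nat.size (i.eval s) + Nat.size (e.eval s) + 1)
        (s.write a (i.eval s) (e.eval s))
  | seq {c d : Program} {s s' s'' : Memory} {t t' : ℕ} :
      Run c s t s' → Run d s' t' s'' → Run (.seq c d) s (t + t' + 1) s''
  | condTrue {e : Expr} {c d : Program} {s s' : Memory} {t : ℕ} :
      e.eval s ≠ 0 → Run c s t s' → Run (.cond e c d) s (e.cost s + t + 1) s'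
  | condFalse {e : Expr} {c d : Program} {s s' : Memory} {t : ℕ} :
      e.eval s = 0 → Run d s t s' → Run (.cond e c d) s (e.cost s + t + 1) s'
  | loopTrue {e : Expr} {c : Program} {s s' s'' : Memory} {t t' : ℕ} :
      e.eval s ≠ 0 → Run c s t s' → Run (.loop e c) s' t' s'' →
        Run (.loop e c) s (e.cost s + t + t' + 1) s''
  | loopFalse {e : Expr} {c : Program} {s : Memory} :
      e.eval s = 0 → Run (.loop e c) s (e.cost s + 1) s

/-- Programs are deterministic: the final memory and the running time are unique. -/
theorem Run.unique {c : Program} {s s₁ : Memory} {t₁ : ℕ} (h₁ : Run c s t₁ s₁) :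
    ∀ {s₂ : Memory} {t₂ : ℕ}, Run c s t₂ s₂ → t₁ = t₂ ∧ s₁ = s₂ := by
  induction h₁ with
  | skip s => intro s₂ t₂ h; cases h; exact ⟨rfl, rfl⟩
  | assign s a i e => intro s₂ t₂ h; cases h; exact ⟨rfl, rfl⟩
  | seq _ _ ih ih' =>
    intro s₂ t₂ h
    cases h with
    | seq h h' =>
      obtain ⟨rfl, rfl⟩ := ih h
      obtain ⟨rfl, rfl⟩ := ih' h'
      exact ⟨rfl, rfl⟩
  | condTrue he _ ih =>
    intro s₂ t₂ h
    cases h with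
    | condTrue _ h => obtain ⟨rfl, rfl⟩ := ih h; exact ⟨rfl, rfl⟩
    | condFalse he' _ => exact absurd he' he
  | condFalse he _ ih =>
    intro s₂ t₂ h
    cases h with
    | condTrue he' _ => exact absurd he he'
    | condFalse _ h => obtain ⟨rfl, rfl⟩ := ih h; exact ⟨rfl, rfl⟩
  | loopTrue he _ _ ih ih' =>
    intro s₂ t₂ h
    cases h with
    | loopTrue _ h h' =>
      obtain ⟨rfl, rfl⟩ := ih h
      obtain ⟨rfl, rfl⟩ := ih' h'
      exact ⟨rfl, rfl⟩
    | loopFalse he' => exact absurd he' he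
  | loopFalse he =>
    intro s₂ t₂ h
    cases h with
    | loopTrue he' _ _ => exact absurd he he'
    | loopFalse _ => exact ⟨rfl, rfl⟩

end Ram

/-! ## Leximin order -/

/-- The entries of a finite real sequence in non-decreasing order. -/
noncomputable def sortedEntries {n : ℕ} (μ : Fin n → ℝ) : Fin n → ℝ := μ ∘ Tuple.sort μ

/-- `μ₁` is leximin larger than `μ₂`: for some `ℓ < n` the `ℓ` smallest entries agree and the
next smallest entry of `μ₁` is greater than that of `μ₂`. -/
def LeximinLarger {n : ℕ} (μ₁ μ₂ : Fin n → ℝ) : Prop :=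
  ∃ ℓ : Fin n, (∀ i < ℓ, sortedEntries μ₁ i = sortedEntries μ₂ i) ∧
    sortedEntries μ₂ ℓ < sortedEntries μ₁ ℓ

/-! ## Trading with a single seller -/

/-- An instance: a single seller with `units` water units of one common value (which therefore
plays no role), `buyers` buyers with positive requirements, and a bipartite compatibility graph
between units and buyers. -/
structure WaterMarket where
  units : ℕ
  buyers : ℕ
  req : Fin buyers → ℕ
  req_pos : ∀ b, 0 < req b
  compat : Fin units → Fin buyers → Bool

namespace WaterMarket

variable (I : WaterMarket)

/-- The number of water units that `T` assigns to the buyer `b`. -/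
def assigned (T : Finset (Fin I.units × Fin I.buyers)) (b : Fin I.buyers) : ℕ :=
  (T.filter fun p => p.2 = b).card

/-- `T` is a trading assignment: units go to compatible buyers, no unit is sold twice, and no
buyer gets more units than required (a matching of the units with the demanded units). -/
structure IsTradingAssignment (T : Finset (Fin I.units × Fin I.buyers)) : Prop where
  compat : ∀ p ∈ T, I.compat p.1 p.2 = true
  unit_once : ∀ p ∈ T, ∀ q ∈ T, p.1 = q.1 → p = q
  le_req : ∀ b, I.assigned T b ≤ I.req b

/-- The buyer satisfaction vector: the fraction of her requirement that each buyer gets. -/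
noncomputable def satisfaction (T : Finset (Fin I.units × Fin I.buyers)) : Fin I.buyers → ℝ :=
  fun b => (I.assigned T b : ℝ) / (I.req b : ℝ)

/-- `T` is a trading assignment with leximin-largest satisfaction vector: against every trading
assignment its vector is leximin larger, or has the same entries up to order. -/
def IsLeximinLargest (T : Finset (Fin I.units × Fin I.buyers)) : Prop :=
  I.IsTradingAssignment T ∧
    ∀ T' : Finset (Fin I.units × Fin I.buyers), I.IsTradingAssignment T' →
      LeximinLarger (I.satisfaction T) (I.satisfaction T') ∨
        sortedEntries (I.satisfaction T) = sortedEntries (I.satisfaction T')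

/-- The size of an instance: one for each unit, each buyer and each entry of the compatibility
matrix, plus the binary lengths of the requirements. -/
def size : ℕ :=
  I.units + I.buyers + I.units * I.buyers + ∑ b, Nat.size (I.req b)

/-- The initial memory: array 0 starts with the numbers of units and buyers, array 1 lists the
requirements, array 2 holds the compatibility matrix row by row; all other cells are 0. -/
def input : Ram.Memory := fun a i =>
  match a with
  | 0 => if i = 0 then I.units else if i = 1 then I.buyers else 0
  | 1 => if h : i < I.buyers then I.req ⟨i, h⟩ else 0
  | 2 => if ∃ (w : Fin I.units) (b : Fin I.buyers),
        i = (w : ℕ) * I.buyers + (b : ℕ) ∧ I.compat w b = true then 1 else 0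
  | _ => 0

/-- The set of pairs found in a final memory: array 3 holds its matrix row by row. -/
def output (s : Ram.Memory) : Finset (Fin I.units × Fin I.buyers) :=
  Finset.univ.filter fun p => s 3 ((p.1 : ℕ) * I.buyers + (p.2 : ℕ)) ≠ 0

end WaterMarket

/-!
# A leximin-largest allocation by a greedy algorithm with alternating paths

The algorithm keeps a trading assignment, encoded by its owner map (unit `w` belongs to buyer
`f w`, and the value `I.buyers` means that `w` is unsold), and a set of closed buyers. In each round
it takes the open buyer who comes first in the order by `η_b / γ_b`, ties broken by the smaller
`γ_b` (`ServedBefore`, `select`). If she can get one more unit while all others keep the number of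
theirs, she gets it along an alternating path (`search`, `follow`); otherwise she is closed. Every
round closes a buyer or sells a unit, so there are at most `I.buyers + I.units` rounds.

For optimality, the leximin order is replaced by a separable cost: if
`∑ b, exp (-l * μ b) ≤ ∑ b, exp (-l * ν b)` for all large `l`, then `μ` is leximin larger than `ν`
or has the same sorted entries (`leximinLarger_or_eq_of_sum_exp_le`). For large `l`, the order in
which the buyers are served is the order of decreasing marginal gains (`eventually_exp_gain_le`). The
greedy algorithm preserves the invariant `Promising`: every trading assignment can be replaced, at
no greater cost, by one that gives each buyer at least what she has now, and exactly that if she is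
closed. This rests on the exchange property of the numbers of units that the buyers can get
(`exists_exchange`): it repairs the replacement after an augmentation (`Promising.augment`), and it
shows that a buyer who cannot be augmented has the same number of units in the replacement
(`Promising.close`). A search that fails certifies that no augmentation exists, by counting the
units compatible with the unmarked buyers (`not_augments_of_saturated`).

For the running time, `Halts` combines termination, a time bound and a bound on the numbers in
the memory in one judgement. Loop-free programs cost polynomial time automatically, since one
pass through them increases binary lengths only polynomially; loops need a variant that is
polynomial in the size of the instance, and a bound `2 ^ I.size` on all numbers between iterations.
-/

/-! ### A program logic for random access machines -/

namespace Ram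

/-- The binary length of the value of an expression and its cost are polynomial in a bound on the
binary lengths of the numbers in the memory. -/
theorem Expr.exists_poly_bound (e : Expr) :
    ∃ p : Polynomial ℕ, ∀ (L : ℕ) (s : Memory), (∀ a i, Nat.size (s a i) ≤ L) →
      Nat.size (e.eval s) ≤ p.eval L ∧ e.cost s ≤ p.eval L := by
  have size_add (m n : ℕ) : Nat.size (m + n) ≤ Nat.size m + Nat.size n + 1 := by
    rw [Nat.size_le]
    have hm := Nat.lt_size_self m
    have hn := Nat.lt_size_self n
    have h1 : 2 ^ m.size ≤ 2 ^ (m.size + n.size) := Nat.pow_le_pow_right (by norm_num) (by omega)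
    have h2 : 2 ^ n.size ≤ 2 ^ (m.size + n.size) := Nat.pow_le_pow_right (by norm_num) (by omega)
    rw [pow_succ]
    omega
  have size_mul (m n : ℕ) : Nat.size (m * n) ≤ Nat.size m + Nat.size n := by
    rw [Nat.size_le, pow_add]
    exact Nat.mul_lt_mul'' (Nat.lt_size_self m) (Nat.lt_size_self n)
  have size_sub (m n : ℕ) : Nat.size (m - n) ≤ Nat.size m := Nat.size_le_size (Nat.sub_le m n)
  induction e with
  | const n =>
    refine ⟨Polynomial.C (n.size + 1), fun L s _ => ?_⟩
    simp [Expr.eval, Expr.cost]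
  | get a i ih =>
    obtain ⟨p, hp⟩ := ih
    refine ⟨2 * p + Polynomial.X + 1, fun L s hs => ?_⟩
    have h := hp L s hs
    have h' := hs a (i.eval s)
    simp only [Expr.eval, Expr.cost, Polynomial.eval_add, Polynomial.eval_mul,
      Polynomial.eval_X, Polynomial.eval_one, Polynomial.eval_ofNat]
    omega
  | add e f ihe ihf =>
    obtain ⟨p, hp⟩ := ihe
    obtain ⟨q, hq⟩ := ihf
    refine ⟨2 * p + 2 * q + 1, fun L s hs => ?_⟩
    have h := hp L s hs
    have h' := hq L s hs
    have := size_add (e.eval s) (f.eval s)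
    simp only [Expr.eval, Expr.cost, Polynomial.eval_add, Polynomial.eval_mul,
      Polynomial.eval_one, Polynomial.eval_ofNat]
    omega
  | sub e f ihe ihf =>
    obtain ⟨p, hp⟩ := ihe
    obtain ⟨q, hq⟩ := ihf
    refine ⟨2 * p + 2 * q + 1, fun L s hs => ?_⟩
    have h := hp L s hs
    have h' := hq L s hs
    have := size_sub (e.eval s) (f.eval s)
    simp only [Expr.eval, Expr.cost, Polynomial.eval_add, Polynomial.eval_mul,
      Polynomial.eval_one, Polynomial.eval_ofNat]
    omega
  | mul e f ihe ihf =>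
    obtain ⟨p, hp⟩ := ihe
    obtain ⟨q, hq⟩ := ihf
    refine ⟨2 * p + 2 * q + 1, fun L s hs => ?_⟩
    have h := hp L s hs
    have h' := hq L s hs
    have := size_mul (e.eval s) (f.eval s)
    simp only [Expr.eval, Expr.cost, Polynomial.eval_add, Polynomial.eval_mul,
      Polynomial.eval_one, Polynomial.eval_ofNat]
    omega

/-- The program contains no loop. -/
def Program.LoopFree : Program → Prop
  | .skip => True
  | .assign _ _ _ => True
  | .seq c d => c.LoopFree ∧ d.LoopFree
  | .cond _ c d => c.LoopFree ∧ d.LoopFree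
  | .loop _ _ => False

/-- The memory in which a loop-free program halts; the value at a loop is irrelevant. -/
def Program.exec : Program → Memory → Memory
  | .skip, s => s
  | .assign a i e, s => s.write a (i.eval s) (e.eval s)
  | .seq c d, s => d.exec (c.exec s)
  | .cond e c d, s => if e.eval s ≠ 0 then c.exec s else d.exec s
  | .loop _ _, s => s

/-- The arrays that a program may write to. -/
def Program.writes : Program → List ℕ
  | .skip => []
  | .assign a _ _ => [a]
  | .seq c d => c.writes ++ d.writes
  | .cond _ c d => c.writes ++ d.writes
  | .loop _ c => c.writes

/-- Arrays that a program does not mention on the left of an assignment keep their content. -/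
theorem Run.frame {c : Program} {s s' : Memory} {t : ℕ} (h : Run c s t s') :
    ∀ a ∉ c.writes, s' a = s a := by
  induction h with
  | skip s => exact fun _ _ => rfl
  | assign s a i e =>
    intro b hb
    funext j
    have : b ≠ a := by simpa [Program.writes] using hb
    simp [Memory.write, this]
  | seq _ _ ih ih' =>
    intro a ha
    simp only [Program.writes, List.mem_append, not_or] at ha
    rw [ih' a ha.2, ih a ha.1]
  | condTrue _ _ ih =>
    intro a ha
    simp only [Program.writes, List.mem_append, not_or] at ha
    exact ih a ha.1
  | condFalse _ _ ih =>
    intro a ha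
    simp only [Program.writes, List.mem_append, not_or] at ha
    exact ih a ha.2
  | loopTrue _ _ _ ih ih' =>
    intro a ha
    rw [ih' a ha, ih a ha]
  | loopFalse _ => exact fun _ _ => rfl

/-- A loop-free program runs in time polynomial in a bound on the binary lengths of the numbers in
its initial memory; no bound on the intermediate memories has to be known in advance. -/
theorem Program.LoopFree.exists_poly_run {c : Program} (hc : c.LoopFree) :
    ∃ p : Polynomial ℕ, ∀ (L : ℕ) (s : Memory), (∀ a i, Nat.size (s a i) ≤ L) →
      (∀ a i, Nat.size (c.exec s a i) ≤ p.eval L) ∧ ∃ t ≤ p.eval L, Run c s t (c.exec s) := by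
  induction c with
  | skip =>
    refine ⟨Polynomial.X + 1, fun L s hs => ⟨fun a i => ?_, 1, ?_, Run.skip s⟩⟩
    · have := hs a i
      simp only [Program.exec, Polynomial.eval_add, Polynomial.eval_X, Polynomial.eval_one]
      omega
    · simp
  | assign a i e =>
    obtain ⟨p, hp⟩ := i.exists_poly_bound
    obtain ⟨q, hq⟩ := e.exists_poly_bound
    refine ⟨Polynomial.X + 2 * p + 2 * q + 1, fun L s hs =>
      ⟨fun b j => ?_, _, ?_, Run.assign s a i e⟩⟩
    · have := hs b j
      have := hq L s hs
      simp only [Program.exec, Memory.write, Polynomial.eval_add, Polynomial.eval_X,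
        Polynomial.eval_one, Polynomial.eval_mul, Polynomial.eval_ofNat]
      split_ifs <;> omega
    · have := hp L s hs
      have := hq L s hs
      simp only [Polynomial.eval_add, Polynomial.eval_X,
        Polynomial.eval_one, Polynomial.eval_mul, Polynomial.eval_ofNat]
      omega
  | seq c d ihc ihd =>
    obtain ⟨p, hp⟩ := ihc hc.1
    obtain ⟨q, hq⟩ := ihd hc.2
    refine ⟨p + q.comp p + 1, fun L s hs => ?_⟩
    obtain ⟨h1, t1, ht1, r1⟩ := hp L s hs
    obtain ⟨h2, t2, ht2, r2⟩ := hq _ _ h1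
    simp only [Polynomial.eval_add, Polynomial.eval_comp, Polynomial.eval_one]
    exact ⟨fun a i => (h2 a i).trans (by omega), _, by omega, r1.seq r2⟩
  | cond e c d ihc ihd =>
    obtain ⟨p, hp⟩ := ihc hc.1
    obtain ⟨q, hq⟩ := ihd hc.2
    obtain ⟨r, hr⟩ := e.exists_poly_bound
    refine ⟨p + q + r + 1, fun L s hs => ?_⟩
    have h := hr L s hs
    simp only [Polynomial.eval_add, Polynomial.eval_one]
    by_cases he : e.eval s = 0
    · obtain ⟨h2, t2, ht2, r2⟩ := hq L s hs
      have : (Program.cond e c d).exec s = d.exec s := by simp [Program.exec, he]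
      rw [this]
      exact ⟨fun a i => (h2 a i).trans (by omega), _, by omega, Run.condFalse he r2⟩
    · obtain ⟨h2, t2, ht2, r2⟩ := hp L s hs
      have : (Program.cond e c d).exec s = c.exec s := by simp [Program.exec, he]
      rw [this]
      exact ⟨fun a i => (h2 a i).trans (by omega), _, by omega, Run.condTrue he r2⟩
  | loop e c => exact hc.elim

/-- All numbers in the memory are at most `2 ^ L`. -/
def Memory.Bounded (L : ℕ) (s : Memory) : Prop := ∀ a i, s a i ≤ 2 ^ L

theorem Memory.Bounded.size_le {L : ℕ} {s : Memory} (h : s.Bounded L) (a i : ℕ) :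
    Nat.size (s a i) ≤ L + 1 :=
  Nat.size_le.2 ((h a i).trans_lt (Nat.pow_lt_pow_right (by norm_num) (by omega)))

theorem Memory.Bounded.write {L : ℕ} {s : Memory} (h : s.Bounded L) {a i v : ℕ}
    (hv : v ≤ 2 ^ L) : (s.write a i v).Bounded L := by
  intro b j
  unfold Memory.write
  split_ifs
  · exact hv
  · exact h b j

/-- Started in memory `s`, the program `c` halts within time `T` in a memory that is bounded by
`2 ^ L` and satisfies `Q`. -/
def Halts (L : ℕ) (c : Program) (s : Memory) (T : ℕ) (Q : Memory → Prop) : Prop :=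
  ∃ t s', Run c s t s' ∧ t ≤ T ∧ s'.Bounded L ∧ Q s'

theorem Halts.mono {L : ℕ} {c : Program} {s : Memory} {T T' : ℕ} {Q Q' : Memory → Prop}
    (h : Halts L c s T Q) (hT : T ≤ T')
    (hQ : ∀ s', s'.Bounded L → (∀ a ∉ c.writes, s' a = s a) → Q s' → Q' s') :
    Halts L c s T' Q' := by
  obtain ⟨t, s', r, ht, hb, hq⟩ := h
  exact ⟨t, s', r, ht.trans hT, hb, hQ s' hb r.frame hq⟩

theorem Halts.seq {L : ℕ} {c d : Program} {s : Memory} {T T' : ℕ} {R Q : Memory → Prop}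
    (h : Halts L c s T R)
    (h' : ∀ s', s'.Bounded L → (∀ a ∉ c.writes, s' a = s a) → R s' → Halts L d s' T' Q) :
    Halts L (.seq c d) s (T + T' + 1) Q := by
  obtain ⟨t, s', r, ht, hb, hq⟩ := h
  obtain ⟨t', s'', r', ht', hb', hq'⟩ := h' s' hb r.frame hq
  exact ⟨_, s'', r.seq r', by omega, hb', hq'⟩

/-- A loop-free program is verified by computing its final memory. -/
theorem Program.LoopFree.exists_poly_halts {c : Program} (hc : c.LoopFree) :
    ∃ p : Polynomial ℕ, ∀ (L : ℕ) (s : Memory) (Q : Memory → Prop), s.Bounded L →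
      (c.exec s).Bounded L → Q (c.exec s) → Halts L c s (p.eval L) Q := by
  obtain ⟨p, hp⟩ := hc.exists_poly_run
  refine ⟨p.comp (Polynomial.X + 1), fun L s Q hs hs' hQ => ?_⟩
  obtain ⟨-, t, ht, r⟩ := hp (L + 1) s hs.size_le
  exact ⟨t, _, r, by simpa [Polynomial.eval_comp] using ht, hs', hQ⟩

/-- The rule for a conditional; its branches may contain loops. -/
theorem Halts.cond {L : ℕ} {e : Expr} {c d : Program} {s : Memory} {E T T' : ℕ}
    {Q : Memory → Prop} (hE : e.cost s ≤ E) (hc : e.eval s ≠ 0 → Halts L c s T Q)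
    (hd : e.eval s = 0 → Halts L d s T' Q) :
    Halts L (.cond e c d) s (E + T + T' + 1) Q := by
  by_cases he : e.eval s = 0
  · obtain ⟨t, s', r, ht, h⟩ := hd he
    exact ⟨_, s', Run.condFalse he r, by omega, h⟩
  · obtain ⟨t, s', r, ht, h⟩ := hc he
    exact ⟨_, s', Run.condTrue he r, by omega, h⟩

theorem Expr.exists_poly_cost (e : Expr) :
    ∃ p : Polynomial ℕ, ∀ (L : ℕ) (s : Memory), s.Bounded L → e.cost s ≤ p.eval L := by
  obtain ⟨p, hp⟩ := e.exists_poly_bound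
  refine ⟨p.comp (Polynomial.X + 1), fun L s hs => ?_⟩
  simpa [Polynomial.eval_comp] using (hp (L + 1) s hs.size_le).2

/-- The rule for a loop with invariant `Inv`, whose first argument is a variant that every
iteration decreases. Arrays that the body does not write stay as they were at the start `s₀`. -/
theorem Halts.loop {L : ℕ} {e : Expr} {c : Program} {s₀ : Memory} {E T : ℕ}
    {Inv : ℕ → Memory → Prop} (hE : ∀ s : Memory, s.Bounded L → e.cost s ≤ E)
    (body : ∀ k s, s.Bounded L → (∀ a ∉ c.writes, s a = s₀ a) → Inv k s → e.eval s ≠ 0 →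
      Halts L c s T fun s' => ∃ k' < k, Inv k' s') {k : ℕ}
    (h₀ : s₀.Bounded L) (hk : Inv k s₀) :
    Halts L (.loop e c) s₀ ((k + 1) * (E + T + 1)) fun s' => e.eval s' = 0 ∧ ∃ k', Inv k' s' := by
  suffices H : ∀ k s, s.Bounded L → (∀ a ∉ c.writes, s a = s₀ a) → Inv k s →
      Halts L (.loop e c) s ((k + 1) * (E + T + 1)) fun s' => e.eval s' = 0 ∧ ∃ k', Inv k' s' from
    H k s₀ h₀ (fun _ _ => rfl) hk
  intro k
  induction k using Nat.strong_induction_on with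
  | _ k ih =>
    intro s hs hf hi
    have hcost := hE s hs
    by_cases he : e.eval s = 0
    · refine ⟨_, s, Run.loopFalse he, ?_, hs, he, k, hi⟩
      nlinarith
    · obtain ⟨t, s', r, ht, hb, k', hk', hi'⟩ := body k s hs hf hi he
      obtain ⟨t', s'', r', ht', h''⟩ :=
        ih k' hk' s' hb (fun a ha => (r.frame a ha).trans (hf a ha)) hi'
      refine ⟨_, s'', Run.loopTrue he r r', ?_, h''⟩
      have : (k' + 1) * (E + T + 1) ≤ k * (E + T + 1) := Nat.mul_le_mul_right _ hk'
      have : (k + 1) * (E + T + 1) = k * (E + T + 1) + (E + T + 1) := by ring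
      omega

/-- The value of a scalar variable, which is kept in cell 0 of an array of its own. -/
abbrev Expr.var (v : ℕ) : Expr := .get v (.const 0)

/-- `for v = 0, …, e - 1 do c`. -/
def Program.forLoop (v : ℕ) (e : Expr) (c : Program) : Program :=
  .seq (.assign v (.const 0) (.const 0))
    (.loop (.sub e (.var v)) (.seq c (.assign v (.const 0) (.add (.var v) (.const 1)))))

/-- The rule for a counting loop. The invariant may mention the loop variable `v` only through its
first argument, and the bound `e` has to keep its value `N` while the loop runs. The polynomial
depends on the time bound `p` of the body, not on the body itself. -/
theorem exists_poly_forLoop (v : ℕ) (e : Expr) (p : Polynomial ℕ) :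
    ∃ q : Polynomial ℕ, ∀ (L : ℕ) (c : Program) (s₀ : Memory) (N : ℕ)
      (Inv : ℕ → Memory → Prop), v ∉ c.writes → s₀.Bounded L → N ≤ L →
      (∀ s : Memory, (∀ a ∉ v :: c.writes, s a = s₀ a) → e.eval s = N) →
      (∀ k s x, Inv k s → Inv k (s.write v 0 x)) →
      (∀ k s, k < N → s.Bounded L → (∀ a ∉ v :: c.writes, s a = s₀ a) → s v 0 = k → Inv k s →
        Halts L c s (p.eval L) (Inv (k + 1))) →
      Inv 0 s₀ → Halts L (.forLoop v e c) s₀ (q.eval L) (Inv N) := by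
  obtain ⟨pe, hpe⟩ := (Expr.sub e (.var v)).exists_poly_cost
  have hlf : (Program.assign v (.const 0) (.add (.var v) (.const 1))).LoopFree := trivial
  obtain ⟨pa, hpa⟩ := hlf.exists_poly_halts
  have hlf' : (Program.assign v (.const 0) (.const 0)).LoopFree := trivial
  obtain ⟨pz, hpz⟩ := hlf'.exists_poly_halts
  refine ⟨pz + (Polynomial.X + 1) * (pe + (p + pa + 1) + 1) + 1, ?_⟩
  intro L c s₀ N Inv hv hs₀ hN heN hstable hbody h0
  have hNL : N ≤ 2 ^ L := hN.trans Nat.lt_two_pow_self.le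
  have hT : ((N + 1) * (pe.eval L + (p.eval L + pa.eval L + 1) + 1)) ≤
      (L + 1) * (pe.eval L + (p.eval L + pa.eval L + 1) + 1) :=
    Nat.mul_le_mul_right _ (by omega)
  refine Halts.mono (T := pz.eval L + ((N + 1) * (pe.eval L + (p.eval L + pa.eval L + 1) + 1)) + 1)
    (Q := Inv N) (Halts.seq (R := fun s => s v 0 = 0 ∧ Inv 0 s) ?_ ?_) (by simpa using hT)
    (fun _ _ _ h => h)
  · refine hpz L s₀ _ hs₀ (hs₀.write (Nat.zero_le _)) ⟨?_, ?_⟩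
    · simp [Program.exec, Memory.write, Expr.eval]
    · exact hstable 0 s₀ _ h0
  · rintro s₁ hs₁ hf₁ ⟨hv0, h1⟩
    have hf₁' : ∀ a ∉ v :: c.writes, s₁ a = s₀ a := fun a ha => hf₁ a (by
      simp only [List.mem_cons, not_or] at ha
      simpa [Program.writes] using ha.1)
    refine (Halts.loop (Inv := fun k s => k = N - s v 0 ∧ s v 0 ≤ N ∧ Inv (s v 0) s)
      (fun s hs => hpe L s hs) ?_ hs₁ (k := N) ⟨by omega, by omega, by rwa [hv0]⟩).mono le_rfl ?_
    · rintro k s hs hf ⟨hk, hle, hi⟩ he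
      have hf' : ∀ a ∉ v :: c.writes, s a = s₀ a := fun a ha => by
        rw [hf a, hf₁' a ha]
        simp only [List.mem_cons, not_or] at ha
        simp [Program.writes, ha.1, ha.2]
      have hev := heN s hf'
      simp only [Expr.eval, hev] at he
      have hlt : s v 0 < N := by omega
      refine (hbody _ s hlt hs hf' rfl hi).seq fun s' hs' hf'' hi' => ?_
      have hv' : s' v 0 = s v 0 := by rw [hf'' v hv]
      refine hpa L s' _ hs' (hs'.write ?_) ?_
      · simp only [Expr.eval, hv']
        omega
      · have hw : (Program.assign v (.const 0) (.add (.var v) (.const 1))).exec s' v 0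
            = s v 0 + 1 := by simp [Program.exec, Memory.write, Expr.eval, hv']
        refine ⟨_, ?_, rfl, ?_, ?_⟩
        · rw [hw]; omega
        · rw [hw]; omega
        · rw [hw]
          exact hstable _ _ _ hi'
    · rintro s' hs' hf ⟨he, k', -, hle, hi⟩
      have hev : e.eval s' = N := heN s' fun a ha => by
        rw [hf a, hf₁' a ha]
        simp only [List.mem_cons, not_or] at ha
        simp [Program.writes, ha.1, ha.2]
      simp only [Expr.eval, hev] at he
      have : s' v 0 = N := by omega
      rwa [this] at hi

end Ram

/-! ### Exchanging units between buyers -/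

/-- The number of elements of `s` that `f` sends to `b`. -/
def load {α β : Type*} [DecidableEq β] (s : Finset α) (f : α → β) (b : β) : ℕ :=
  (s.filter fun w => f w = b).card

section Exchange

variable {α β : Type*} [DecidableEq α] [DecidableEq β]

theorem load_update (s : Finset α) (f : α → β) {w : α} (hw : w ∈ s) (b x : β) :
    load s (Function.update f w b) x + (if x = f w then 1 else 0) =
      load s f x + (if x = b then 1 else 0) := by
  have key : ∑ v ∈ s.erase w, (if Function.update f w b v = x then 1 else 0) =
      ∑ v ∈ s.erase w, (if f v = x then 1 else 0) :=
    Finset.sum_congr rfl fun v hv => by rw [Function.update_of_ne (Finset.ne_of_mem_erase hv)]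
  simp only [load, Finset.card_filter]
  rw [← Finset.add_sum_erase s _ hw,
    ← Finset.add_sum_erase s (fun v => if f v = x then 1 else 0) hw, key]
  simp only [Function.update_self, eq_comm (a := x)]
  omega

/-- Exchange property of loads: if `g` loads `b` more than `f` does, then one unit of load can be
added to `b` at the expense of the sentinel `o` or of some `c` that `f` loads more than `g` does.
The new map is obtained by moving elements of `s` along an alternating path. -/
theorem exists_exchange (s : Finset α) (o : β) (f g : α → β) {b : β} (hb : b ≠ o)
    (hlt : load s f b < load s g b) :
    ∃ (h : α → β) (c : β), c ≠ b ∧ (∀ w, h w = f w ∨ h w = g w) ∧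
      (c = o ∨ load s g c < load s f c) ∧
      ∀ x, load s h x + (if x = c then 1 else 0) = load s f x + (if x = b then 1 else 0) := by
  induction hm : (s.filter fun w => f w ≠ g w).card using Nat.strong_induction_on
    generalizing f b with
  | _ m ih =>
    obtain ⟨w, hws, hgw, hfw⟩ : ∃ w ∈ s, g w = b ∧ f w ≠ b := by
      by_contra! hcon
      refine absurd (Finset.card_le_card fun w hw => ?_) (not_le.2 hlt)
      rw [Finset.mem_filter] at hw ⊢
      exact ⟨hw.1, hcon w hw.1 hw.2⟩
    have hload := load_update s f hws b
    have hval : ∀ v, Function.update f w b v = f v ∨ Function.update f w b v = g v := by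
      intro v
      rcases eq_or_ne v w with rfl | hv
      · exact Or.inr (by simp [hgw])
      · exact Or.inl (Function.update_of_ne hv _ _)
    by_cases hc : f w = o ∨ load s g (f w) < load s f (f w)
    · exact ⟨_, f w, hfw, hval, hc, hload⟩
    · -- Now `f w` has lost an element and is loaded less than `g` loads it, so the path goes on.
      push Not at hc
      have h1 := hload (f w)
      simp only [if_true, hfw, if_false] at h1
      have hlt' : (s.filter fun v => Function.update f w b v ≠ g v).card < m := by
        rw [← hm]
        refine Finset.card_lt_card (Finset.ssubset_iff_of_subset (fun v hv => ?_) |>.2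
          ⟨w, ?_, ?_⟩)
        · rw [Finset.mem_filter] at hv ⊢
          refine ⟨hv.1, fun hfg => hv.2 ?_⟩
          rcases hval v with h | h
          · rw [h, hfg]
          · exact h
        · simp [hws, hgw, hfw]
        · simp [hgw]
      obtain ⟨h, c, hcne, hh, hco, hx⟩ := ih _ hlt' (Function.update f w b) hc.1 (by omega) rfl
      have hcb : c ≠ b := by
        rintro rfl
        have h2 := hload c
        simp only [if_true, hfw.symm, if_false] at h2
        rcases hco with h3 | h3
        · exact hb h3
        · omega
      refine ⟨h, c, hcb, fun v => ?_, ?_, fun x => ?_⟩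
      · rcases hh v with h3 | h3
        · rw [h3]; exact hval v
        · exact Or.inr h3
      · refine hco.imp_right fun h3 => ?_
        have h2 := hload c
        simp only [hcne, hcb, if_false] at h2
        omega
      · rw [hx x, hload x]

end Exchange

/-! ### The invariant of the greedy algorithm -/

namespace WaterMarket

variable (I : WaterMarket)

/-- Compatibility of the unit and the buyer with given numbers. -/
def Edge (w b : ℕ) : Prop :=
  ∃ (hw : w < I.units) (hb : b < I.buyers), I.compat ⟨w, hw⟩ ⟨b, hb⟩ = true

/-- The number of units that buyer `b` owns under the owner map `f`. -/
abbrev sold (f : ℕ → ℕ) (b : ℕ) : ℕ := load (Finset.range I.units) f b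

/-- An owner map describes a trading assignment: `f w` is the buyer who gets the unit `w`, and the
value `I.buyers` marks the unit as unsold. -/
structure IsOwnerMap (f : ℕ → ℕ) : Prop where
  edge : ∀ w < I.units, f w = I.buyers ∨ I.Edge w (f w)
  le_req : ∀ b < I.buyers, I.sold f b ≤ I.input 1 b

/-- The owner map `f'` gives one more unit to buyer `b`, and as many as `f` to all others. -/
def Augments (f f' : ℕ → ℕ) (b : ℕ) : Prop :=
  I.IsOwnerMap f' ∧ ∀ x < I.buyers, I.sold f' x = I.sold f x + if x = b then 1 else 0

/-- The cost of an owner map, where a buyer `b` who gets `j` units costs `φ b j`. -/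
def totalCost (φ : ℕ → ℕ → ℝ) (f : ℕ → ℕ) : ℝ := ∑ b ∈ Finset.range I.buyers, φ b (I.sold f b)

/-- Invariant of the greedy algorithm: every owner map `g` can be replaced, at no greater cost, by
one that gives each buyer at least what `f` does, and exactly that to the closed buyers. -/
def Promising (φ : ℕ → ℕ → ℝ) (f : ℕ → ℕ) (closed : ℕ → Prop) : Prop :=
  ∀ g, I.IsOwnerMap g → ∃ h, I.IsOwnerMap h ∧ I.totalCost φ h ≤ I.totalCost φ g ∧
    ∀ c < I.buyers, I.sold f c ≤ I.sold h c ∧ (closed c → I.sold h c = I.sold f c)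

variable {I}

theorem sold_le_units (f : ℕ → ℕ) (b : ℕ) : I.sold f b ≤ I.units :=
  (Finset.card_filter_le _ _).trans (by simp)

theorem IsOwnerMap.le_buyers {f : ℕ → ℕ} (hf : I.IsOwnerMap f) {w : ℕ} (hw : w < I.units) :
    f w ≤ I.buyers := by
  rcases hf.edge w hw with h | ⟨_, h, _⟩ <;> omega

theorem IsOwnerMap.of_exchange {f g h : ℕ → ℕ} {b c : ℕ} (hf : I.IsOwnerMap f)
    (hg : I.IsOwnerMap g) (hh : ∀ w, h w = f w ∨ h w = g w) (hlt : I.sold f b < I.sold g b)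
    (hx : ∀ x, I.sold h x + (if x = c then 1 else 0) = I.sold f x + if x = b then 1 else 0) :
    I.IsOwnerMap h := by
  refine ⟨fun w hw => ?_, fun x hxn => ?_⟩
  · rcases hh w with h1 | h1 <;> rw [h1]
    exacts [hf.edge w hw, hg.edge w hw]
  · have h1 := hx x
    have h2 := hf.le_req x hxn
    by_cases hxb : x = b
    · subst hxb
      have h3 := hg.le_req x hxn
      rw [if_pos rfl] at h1
      omega
    · rw [if_neg hxb] at h1
      omega

/-- A buyer `b` whose next unit has the largest gain can be augmented: if the replacement `h` does
not give her the additional unit yet, the exchange of `h` with `f'` does so at the expense of a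
buyer who is still open and has more units than under `f'`, or of nobody. -/
theorem Promising.augment {φ : ℕ → ℕ → ℝ} {f f' : ℕ → ℕ} {closed : ℕ → Prop} {b : ℕ}
    (hP : I.Promising φ f closed) (hb : b < I.buyers) (hbc : ¬closed b) (hf' : I.Augments f f' b)
    (hmono : φ b (I.sold f b + 1) ≤ φ b (I.sold f b))
    (hsel : ∀ c < I.buyers, ¬closed c → ∀ j, I.sold f c ≤ j → j < I.units →
      φ c j - φ c (j + 1) ≤ φ b (I.sold f b) - φ b (I.sold f b + 1)) :
    I.Promising φ f' closed := by
  intro g hg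
  obtain ⟨h, hh, hcost, hge⟩ := hP g hg
  have hfb := hf'.2 b hb
  rw [if_pos rfl] at hfb
  by_cases hhb : I.sold f b < I.sold h b
  · refine ⟨h, hh, hcost, fun c hc => ?_⟩
    have h1 := hf'.2 c hc
    have h2 := hge c hc
    by_cases hcb : c = b
    · subst hcb
      exact ⟨by omega, fun h3 => absurd h3 hbc⟩
    · rw [if_neg hcb] at h1
      exact ⟨by omega, fun h3 => by rw [h1]; exact h2.2 h3⟩
  · have hhb' : I.sold h b = I.sold f b := le_antisymm (not_lt.1 hhb) (hge b hb).1
    have hlt : I.sold h b < I.sold f' b := by omega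
    obtain ⟨h', c, hcb, hval, hc, hx⟩ :=
      exists_exchange (Finset.range I.units) I.buyers h f' hb.ne hlt
    have hh' : I.IsOwnerMap h' := hh.of_exchange hf'.1 hval hlt hx
    have hcn : c < I.buyers → I.sold f' c < I.sold h c := fun h1 =>
      hc.resolve_left h1.ne
    refine ⟨h', hh', le_trans ?_ hcost, fun x hxn => ?_⟩
    · have hterm : ∀ x ∈ Finset.range I.buyers, φ x (I.sold h' x) = φ x (I.sold h x)
          - (if x = b then φ b (I.sold f b) - φ b (I.sold f b + 1) else 0)
          + (if x = c then φ c (I.sold h c - 1) - φ c (I.sold h c) else 0) := by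
        intro x hxn
        rw [Finset.mem_range] at hxn
        have h1 := hx x
        by_cases hxb : x = b
        · subst hxb
          rw [if_neg hcb.symm, if_pos rfl] at h1
          rw [if_neg hcb.symm, if_pos rfl]
          have h2 : I.sold h' x = I.sold f x + 1 := by rw [← hhb']; exact h1
          rw [h2, hhb']
          ring
        · rw [if_neg hxb] at h1 ⊢
          by_cases hxc : x = c
          · subst hxc
            rw [if_pos rfl] at h1 ⊢
            have h2 : I.sold h' x = I.sold h x - 1 := by
              have : I.sold h' x + 1 = I.sold h x := h1
              omega
            rw [h2]
            ring
          · rw [if_neg hxc] at h1 ⊢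
            have h2 : I.sold h' x = I.sold h x := h1
            rw [h2]
            ring
      unfold totalCost
      rw [Finset.sum_congr rfl hterm, Finset.sum_add_distrib, Finset.sum_sub_distrib,
        Finset.sum_ite_eq', Finset.sum_ite_eq', if_pos (Finset.mem_range.2 hb)]
      by_cases hcb' : c < I.buyers
      · rw [if_pos (Finset.mem_range.2 hcb')]
        have h1 := hcn hcb'
        have h2 := hf'.2 c hcb'
        rw [if_neg hcb] at h2
        have hopen : ¬closed c := fun h3 => by
          have := (hge c hcb').2 h3
          omega
        have h3 := sold_le_units (I := I) h c
        have h4 := hsel c hcb' hopen (I.sold h c - 1) (by omega) (by omega)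
        rw [show I.sold h c - 1 + 1 = I.sold h c by omega] at h4
        linarith
      · rw [if_neg (by simpa using hcb')]
        linarith
    · have h1 := hx x
      have h2 := hf'.2 x hxn
      have h3 := hge x hxn
      by_cases hxb : x = b
      · subst hxb
        rw [if_neg hcb.symm, if_pos rfl] at h1
        have h4 : I.sold h' x = I.sold h x + 1 := h1
        exact ⟨by omega, fun h3 => absurd h3 hbc⟩
      · rw [if_neg hxb] at h1 h2
        by_cases hxc : x = c
        · subst hxc
          rw [if_pos rfl] at h1
          have h4 := hcn hxn
          have h5 : I.sold h' x + 1 = I.sold h x := h1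
          exact ⟨by omega, fun h6 => by have := h3.2 h6; omega⟩
        · rw [if_neg hxc] at h1
          have h5 : I.sold h' x = I.sold h x := h1
          exact ⟨by omega, fun h6 => by have := h3.2 h6; omega⟩

/-- A buyer without augmentation can be closed: if a replacement gave her more units, the exchange
of `f` with it could only draw on unsold units, and so would augment her. -/
theorem Promising.close {φ : ℕ → ℕ → ℝ} {f : ℕ → ℕ} {closed : ℕ → Prop} {b : ℕ}
    (hP : I.Promising φ f closed) (hf : I.IsOwnerMap f) (hb : b < I.buyers)
    (hno : ¬∃ f', I.Augments f f' b) : I.Promising φ f fun c => c = b ∨ closed c := by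
  intro g hg
  obtain ⟨h, hh, hcost, hge⟩ := hP g hg
  refine ⟨h, hh, hcost, fun c hc => ⟨(hge c hc).1, ?_⟩⟩
  rintro (rfl | h1)
  · by_contra hne
    have hlt : I.sold f c < I.sold h c := lt_of_le_of_ne (hge c hb).1 (Ne.symm hne)
    obtain ⟨f', d, hdc, hval, hd, hx⟩ :=
      exists_exchange (Finset.range I.units) I.buyers f h hb.ne hlt
    refine hno ⟨f', hf.of_exchange hh hval hlt hx, fun x hxn => ?_⟩
    have h1 := hx x
    have hxd : x ≠ d := by
      rintro rfl
      rcases hd with h2 | h2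
      · exact hxn.ne h2
      · exact absurd h2 (not_lt.2 (hge x hxn).1)
    rw [if_neg hxd] at h1
    exact h1
  · exact (hge c hc).2 h1

theorem Promising.cost_le {φ : ℕ → ℕ → ℝ} {f : ℕ → ℕ} {closed : ℕ → Prop}
    (hP : I.Promising φ f closed) (hclosed : ∀ c < I.buyers, closed c) {g : ℕ → ℕ}
    (hg : I.IsOwnerMap g) : I.totalCost φ f ≤ I.totalCost φ g := by
  obtain ⟨h, -, hcost, hge⟩ := hP g hg
  refine le_trans (le_of_eq ?_) hcost
  refine Finset.sum_congr rfl fun c hc => ?_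
  have hc' := Finset.mem_range.1 hc
  rw [(hge c hc').2 (hclosed c hc')]

/-- Hall-type obstruction to an augmentation: when the unmarked buyers own every unit that is
compatible with one of them, they cannot get more units in total. -/
theorem not_augments_of_saturated {f : ℕ → ℕ} {marked : ℕ → Prop} {b : ℕ} (hf : I.IsOwnerMap f)
    (hn : marked I.buyers)
    (hsat : ∀ c < I.buyers, ∀ w < I.units, I.Edge w c → marked (f w) → marked c)
    (hb : b < I.buyers) (hbm : ¬marked b) : ¬∃ f', I.Augments f f' b := by
  classical
  rintro ⟨f', hf', hx⟩
  set R := (Finset.range I.buyers).filter fun c => ¬marked c with hR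
  have hsum : ∀ g : ℕ → ℕ, ∑ c ∈ R, I.sold g c =
      ((Finset.range I.units).filter fun w => g w ∈ R).card := by
    intro g
    rw [Finset.card_eq_sum_card_fiberwise (f := g) (t := R)
      (s := (Finset.range I.units).filter fun w => g w ∈ R) (fun w hw => (Finset.mem_filter.1 hw).2)]
    refine Finset.sum_congr rfl fun c hc => ?_
    unfold sold load
    rw [Finset.filter_filter]
    congr 1
    refine Finset.filter_congr fun w _ => ⟨fun h => ⟨h ▸ hc, h⟩, fun h => h.2⟩
  have hsub : ((Finset.range I.units).filter fun w => f' w ∈ R).card ≤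
      ((Finset.range I.units).filter fun w => f w ∈ R).card := by
    refine Finset.card_le_card fun w hw => ?_
    simp only [hR, Finset.mem_filter, Finset.mem_range] at hw ⊢
    obtain ⟨hw, hlt, hm⟩ := hw
    have hE : I.Edge w (f' w) := (hf'.edge w hw).resolve_left hlt.ne
    have hm' : ¬marked (f w) := fun h => hm (hsat _ hlt w hw hE h)
    refine ⟨hw, lt_of_le_of_ne (hf.le_buyers hw) fun h => hm' (h ▸ hn), hm'⟩
  rw [← hsum, ← hsum] at hsub
  have hbR : b ∈ R := by simp [hR, hb, hbm]
  have : ∑ c ∈ R, I.sold f' c = ∑ c ∈ R, I.sold f c + 1 := by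
    rw [Finset.sum_congr rfl fun c hc => hx c (by
      simp only [hR, Finset.mem_filter, Finset.mem_range] at hc; exact hc.1),
      Finset.sum_add_distrib, Finset.sum_ite_eq', if_pos hbR]
  omega

end WaterMarket

/-! ### The leximin order and exponential costs -/

open Filter in
theorem eventually_mul_exp_neg_lt_one (C : ℝ) {d : ℝ} (hd : 0 < d) :
    ∀ᶠ l : ℝ in atTop, C * Real.exp (-(l * d)) < 1 := by
  have h1 : Tendsto (fun l : ℝ => Real.exp (-(l * d))) atTop (nhds 0) :=
    Real.tendsto_exp_neg_atTop_nhds_zero.comp (tendsto_id.atTop_mul_const hd)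
  have h2 : Tendsto (fun l : ℝ => C * Real.exp (-(l * d))) atTop (nhds 0) := by
    simpa using h1.const_mul C
  exact h2.eventually_lt_const one_pos

open Filter in
/-- For large `l`, the sum of the `exp (-l * μ b)` is dominated by the smallest entries of `μ`, so
that comparing these sums amounts to comparing the vectors in the leximin order. -/
theorem leximinLarger_or_eq_of_sum_exp_le {n : ℕ} {μ ν : Fin n → ℝ}
    (h : ∀ᶠ l : ℝ in atTop, ∑ b, Real.exp (-(l * μ b)) ≤ ∑ b, Real.exp (-(l * ν b))) :
    LeximinLarger μ ν ∨ sortedEntries μ = sortedEntries ν := by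
  classical
  by_contra! hcon
  obtain ⟨hnl, hne⟩ := hcon
  have hex : (Finset.univ.filter fun i => sortedEntries μ i ≠ sortedEntries ν i).Nonempty := by
    obtain ⟨i, hi⟩ := Function.ne_iff.1 hne
    exact ⟨i, by simpa using hi⟩
  obtain ⟨m, hm, hmin⟩ := Finset.exists_min_image _ id hex
  rw [Finset.mem_filter] at hm
  have heq : ∀ i < m, sortedEntries μ i = sortedEntries ν i := by
    intro i hi
    by_contra hc
    exact absurd (hmin i (by simpa using hc)) (not_le.2 hi)
  have hlt : sortedEntries μ m < sortedEntries ν m := by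
    refine lt_of_le_of_ne (not_lt.1 fun h1 => hnl ⟨m, heq, h1⟩) hm.2
  have hmono : Monotone (sortedEntries ν) := Tuple.monotone_sort ν
  have hsum : ∀ (κ : Fin n → ℝ) (l : ℝ),
      ∑ b, Real.exp (-(l * κ b)) = ∑ b, Real.exp (-(l * sortedEntries κ b)) := fun κ l =>
    (Equiv.sum_comp (Tuple.sort κ) fun b => Real.exp (-(l * κ b))).symm
  obtain ⟨l, hl, hl1, hl0⟩ := (h.and ((eventually_mul_exp_neg_lt_one n (sub_pos.2 hlt)).and
    (eventually_ge_atTop 0))).exists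
  rw [hsum μ, hsum ν, ← Finset.sum_filter_add_sum_filter_not Finset.univ (· < m),
    ← Finset.sum_filter_add_sum_filter_not Finset.univ (· < m)
      (fun b => Real.exp (-(l * sortedEntries ν b))),
    Finset.sum_congr rfl (g := fun b => Real.exp (-(l * sortedEntries ν b)))
      (fun b hb => by rw [heq b (by simpa using hb)])] at hl
  have h1 : Real.exp (-(l * sortedEntries μ m)) ≤
      ∑ b with ¬b < m, Real.exp (-(l * sortedEntries μ b)) :=
    Finset.single_le_sum (f := fun b => Real.exp (-(l * sortedEntries μ b)))
      (fun b _ => (Real.exp_pos _).le) (by simp)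
  have h2 : ∑ b with ¬b < m, Real.exp (-(l * sortedEntries ν b)) ≤
      n * Real.exp (-(l * sortedEntries ν m)) := by
    refine (Finset.sum_le_card_nsmul _ _ (Real.exp (-(l * sortedEntries ν m))) fun b hb => ?_).trans
      ?_
    · have : m ≤ b := by simpa using hb
      have := mul_le_mul_of_nonneg_left (hmono this) hl0
      exact Real.exp_le_exp.2 (by linarith)
    · rw [nsmul_eq_mul]
      refine mul_le_mul_of_nonneg_right ?_ (Real.exp_pos _).le
      exact_mod_cast (Finset.card_filter_le _ _).trans (by simp)
  have h3 : Real.exp (-(l * sortedEntries ν m)) =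
      Real.exp (-(l * (sortedEntries ν m - sortedEntries μ m))) *
        Real.exp (-(l * sortedEntries μ m)) := by
    rw [← Real.exp_add]
    congr 1
    ring
  have h4 := Real.exp_pos (-(l * sortedEntries μ m))
  rw [h3, ← mul_assoc] at h2
  nlinarith

open Filter in
/-- Raising the satisfaction of a buyer with requirement `r` from `j / r` to `(j + 1) / r` pays off
at least as much, for large `l`, as raising that of a buyer with requirement `q` from `i / q` to
`(i + 1) / q`, unless `i / q` is smaller than `j / r` or it is equal and `q < r`. -/
theorem eventually_exp_gain_le {q r i j : ℕ} (hq : 0 < q) (hr : 0 < r)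
    (h : j * q < i * r ∨ j * q = i * r ∧ r ≤ q) :
    ∀ᶠ l : ℝ in atTop,
      Real.exp (-(l * (i / q : ℝ))) - Real.exp (-(l * ((i + 1 : ℕ) / q : ℝ))) ≤
        Real.exp (-(l * (j / r : ℝ))) - Real.exp (-(l * ((j + 1 : ℕ) / r : ℝ))) := by
  have hq' : (0 : ℝ) < q := by exact_mod_cast hq
  have hr' : (0 : ℝ) < r := by exact_mod_cast hr
  have hsplit : ∀ (l : ℝ) (a p : ℕ), Real.exp (-(l * ((a + 1 : ℕ) / p : ℝ))) =
      Real.exp (-(l * (a / p : ℝ))) * Real.exp (-(l * (1 / p : ℝ))) := by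
    intro l a p
    rw [← Real.exp_add]
    congr 1
    push_cast
    ring
  rcases h with h | ⟨h, hle⟩
  · have hd : (0 : ℝ) < i / q - j / r := by
      rw [sub_pos, div_lt_div_iff₀ hr' hq']
      exact_mod_cast h
    filter_upwards [eventually_mul_exp_neg_lt_one 2 hd,
      eventually_mul_exp_neg_lt_one 2 (one_div_pos.2 hr')] with l h1 h2
    rw [hsplit l j r]
    have h3 := Real.exp_pos (-(l * ((i + 1 : ℕ) / q : ℝ)))
    have h4 := Real.exp_pos (-(l * (j / r : ℝ)))
    have h5 : Real.exp (-(l * (i / q : ℝ))) =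
        Real.exp (-(l * (i / q - j / r : ℝ))) * Real.exp (-(l * (j / r : ℝ))) := by
      rw [← Real.exp_add]
      congr 1
      ring
    rw [h5]
    nlinarith
  · have heq : (i / q : ℝ) = j / r := by
      rw [div_eq_div_iff hq'.ne' hr'.ne']
      exact_mod_cast h.symm
    filter_upwards [eventually_ge_atTop 0] with l hl
    rw [hsplit, hsplit, heq]
    have h1 : Real.exp (-(l * (1 / r : ℝ))) ≤ Real.exp (-(l * (1 / q : ℝ))) := by
      have : (1 / q : ℝ) ≤ 1 / r := one_div_le_one_div_of_le hr' (by exact_mod_cast hle)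
      have := mul_le_mul_of_nonneg_left this hl
      exact Real.exp_le_exp.2 (by linarith)
    have h2 := Real.exp_pos (-(l * (j / r : ℝ)))
    nlinarith

/-! ### The program: memory layout and selection of a buyer

Beyond the input arrays `0`, `1`, `2` and the output array `3`, the program uses
* array `4`: the owner map, with `I.buyers` for an unsold unit;
* array `5`: the number of units each buyer owns; cell `I.buyers` holds the sentinel value `1`;
* array `6`: nonzero for closed buyers;
* arrays `7` and `8`: for a marked buyer, her (nonzero) rank and the next unit on her path to an
  unsold unit; cell `I.buyers` of array `7` stands for the unsold units and always has rank `1`;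
* the scalars `9` (a buyer), `10` (a unit), `11` (the selected buyer), `12` (the number of marked
  cells), `13` (whether a scan marked anything), `14`, `15`, `16` (a buyer, her next unit, and the
  owner of that unit, on the way along a path). -/

namespace WaterMarket

open Ram Program Expr

/-- The number of units of the instance, as an expression. -/
def unitsExpr : Expr := .get 0 (.const 0)

/-- The number of buyers of the instance, as an expression. -/
def buyersExpr : Expr := .get 0 (.const 1)

/-- The input arrays are intact and the output array is empty. -/
structure Base (I : WaterMarket) (s : Memory) : Prop where
  input_eq : ∀ a < 4, s a = I.input a

/-- The order in which buyers are served: a buyer with `j` of `r` required units comes no later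
than one with `i` of `q` if `j / r < i / q`, or `j / r = i / q` and `r ≤ q`. -/
def ServedBefore (j r i q : ℕ) : Prop := j * q < i * r ∨ j * q = i * r ∧ r ≤ q

theorem ServedBefore.trans {j r i q m p : ℕ} (h₁ : ServedBefore j r i q)
    (h₂ : ServedBefore i q m p) (hr : 0 < r) (hq : 0 < q) (hp : 0 < p) :
    ServedBefore j r m p := by
  have e1 : j * p * q = (j * q) * p := by ring
  have e2 : m * r * q = (m * q) * r := by ring
  have e3 : i * r * p = (i * p) * r := by ring
  rcases h₁ with h₁ | ⟨h₁, h₁'⟩ <;> rcases h₂ with h₂ | ⟨h₂, h₂'⟩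
  · refine Or.inl (lt_of_mul_lt_mul_right (a := q) ?_ (Nat.zero_le _))
    have a1 := Nat.mul_lt_mul_of_pos_right h₁ hp
    have a2 := Nat.mul_lt_mul_of_pos_right h₂ hr
    omega
  · refine Or.inl (lt_of_mul_lt_mul_right (a := q) ?_ (Nat.zero_le _))
    have a1 := Nat.mul_lt_mul_of_pos_right h₁ hp
    have a2 := congrArg (· * r) h₂
    omega
  · refine Or.inl (lt_of_mul_lt_mul_right (a := q) ?_ (Nat.zero_le _))
    have a1 := congrArg (· * p) h₁
    have a2 := Nat.mul_lt_mul_of_pos_right h₂ hr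
    omega
  · refine Or.inr ⟨Nat.eq_of_mul_eq_mul_right hq ?_, h₁'.trans h₂'⟩
    have a1 := congrArg (· * p) h₁
    have a2 := congrArg (· * r) h₂
    omega

theorem ServedBefore.total {j r i q : ℕ} (h : ¬ServedBefore j r i q) : ServedBefore i q j r := by
  unfold ServedBefore at *
  omega

variable {I : WaterMarket} {s : Memory}

theorem units_le_size : I.units ≤ I.size := by unfold size; omega

theorem buyers_le_size : I.buyers ≤ I.size := by unfold size; omega

theorem Base.units_eq (h : I.Base s) : s 0 0 = I.units := by
  rw [h.input_eq 0 (by norm_num)]; rfl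

theorem Base.buyers_eq (h : I.Base s) : s 0 1 = I.buyers := by
  rw [h.input_eq 0 (by norm_num)]; rfl

theorem Base.req_eq (h : I.Base s) (b : ℕ) : s 1 b = I.input 1 b := by
  rw [h.input_eq 1 (by norm_num)]

theorem input_one_pos {b : ℕ} (hb : b < I.buyers) : 0 < I.input 1 b := by
  simp [input, hb, I.req_pos]

theorem input_one_buyers : I.input 1 I.buyers = 0 := by simp [input]

theorem Base.compat_ne_zero_iff (h : I.Base s) {w b : ℕ} (hw : w < I.units) (hb : b < I.buyers) :
    s 2 (w * I.buyers + b) ≠ 0 ↔ I.Edge w b := by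
  rw [h.input_eq 2 (by norm_num)]
  simp only [input, ne_eq, ite_eq_right_iff, one_ne_zero, imp_false, not_not]
  constructor
  · rintro ⟨w', b', heq, hc⟩
    have hpos : 0 < I.buyers := by omega
    have h1 : w = w' := by
      have := congrArg (· / I.buyers) heq
      simpa [Nat.add_div_of_dvd_right, Nat.mul_div_cancel _ hpos, Nat.div_eq_of_lt hb,
        Nat.div_eq_of_lt b'.2, Nat.add_comm (_ * _), Nat.add_mul_div_right _ _ hpos] using this
    have h2 : b = b' := by subst h1; omega
    subst h1 h2
    exact ⟨w'.2, b'.2, hc⟩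
  · rintro ⟨hw, hb, hc⟩
    exact ⟨⟨w, hw⟩, ⟨b, hb⟩, rfl, hc⟩

theorem Base.of_frame {s' : Memory} (h : I.Base s) (hf : ∀ a < 4, s' a = s a) : I.Base s' :=
  ⟨fun a ha => (hf a ha).trans (h.input_eq a ha)⟩

/-- Nonzero if and only if the buyer in variable `9` is open and to be served strictly before the
selected buyer. The sentinel `I.buyers` owns one of zero required units, so that it comes last. -/
def betterExpr : Expr :=
  let x : Expr := .mul (.get 5 (.var 11)) (.get 1 (.var 9))
  let y : Expr := .mul (.get 5 (.var 9)) (.get 1 (.var 11))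
  .mul (.sub (.const 1) (.get 6 (.var 9)))
    (.add (.sub x y) (.mul (.sub (.const 1) (.sub y x)) (.sub (.get 1 (.var 11)) (.get 1 (.var 9)))))

/-- The body of the loop that selects a buyer. -/
def selectStep : Program := .cond betterExpr (.assign 11 (.const 0) (.var 9)) .skip

/-- Select the open buyer who is to be served next, or `I.buyers` if all buyers are closed. -/
def select : Program :=
  .seq (.assign 11 (.const 0) buyersExpr) (.forLoop 9 buyersExpr selectStep)

/-- The selected buyer is open and to be served before all open buyers with numbers below `m`, or
the selection is `I.buyers` and there are no such open buyers. -/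
def SelectedAmong (I : WaterMarket) (m : ℕ) (s : Memory) : Prop :=
  s 11 0 = I.buyers ∧ (∀ c < m, s 6 c ≠ 0) ∨
    s 11 0 < I.buyers ∧ s 6 (s 11 0) = 0 ∧ ∀ c < m, s 6 c = 0 →
      ServedBefore (s 5 (s 11 0)) (I.input 1 (s 11 0)) (s 5 c) (I.input 1 c)

theorem betterExpr_eval_ne_zero : betterExpr.eval s ≠ 0 ↔ s 6 (s 9 0) = 0 ∧
    ¬ServedBefore (s 5 (s 11 0)) (s 1 (s 11 0)) (s 5 (s 9 0)) (s 1 (s 9 0)) := by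
  simp only [betterExpr, Expr.eval, ServedBefore, Ne, mul_eq_zero, Nat.add_eq_zero_iff, not_or]
  omega

theorem exists_poly_select : ∃ p : Polynomial ℕ, ∀ (I : WaterMarket) (s : Memory),
    s.Bounded I.size → I.Base s → s 5 I.buyers = 1 →
      Halts I.size select s (p.eval I.size) (I.SelectedAmong I.buyers) := by
  have hlf : selectStep.LoopFree := ⟨trivial, trivial⟩
  obtain ⟨ps, hps⟩ := hlf.exists_poly_halts
  have hla : (Program.assign 11 (.const 0) buyersExpr).LoopFree := trivial
  obtain ⟨pa, hpa⟩ := hla.exists_poly_halts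
  obtain ⟨q, hq⟩ := exists_poly_forLoop 9 buyersExpr ps
  refine ⟨pa + q + 1, fun I s hs hB h5 => ?_⟩
  have hn : I.buyers ≤ 2 ^ I.size := buyers_le_size.trans Nat.lt_two_pow_self.le
  rw [Polynomial.eval_add, Polynomial.eval_add, Polynomial.eval_one]
  refine Halts.seq (R := fun s' => s' 11 0 = I.buyers) (hpa _ _ _ hs (hs.write ?_) ?_) ?_
  · simpa [buyersExpr, Expr.eval, hB.buyers_eq] using hn
  · simp [Program.exec, Memory.write, buyersExpr, Expr.eval, hB.buyers_eq]
  intro s₁ hs₁ hf₁ h11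
  have hB₁ : I.Base s₁ := hB.of_frame fun a ha => hf₁ a (by simp [Program.writes]; omega)
  have h5₁ : s₁ 5 I.buyers = 1 := by rw [hf₁ 5 (by decide), h5]
  refine hq _ _ s₁ I.buyers (I.SelectedAmong) (by decide) hs₁ buyers_le_size ?_ ?_ ?_ ?_
  · intro s' hf'
    simp only [buyersExpr, Expr.eval, hf' 0 (by decide), hB₁.buyers_eq]
  · intro k s' x h
    simpa [SelectedAmong, Memory.write] using h
  · intro k s' hk hs' hf' h9 hi
    have hB' : I.Base s' := hB₁.of_frame fun a ha => hf' a (by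
      simp [Program.writes, selectStep]; omega)
    have h5' : s' 5 I.buyers = 1 := by rw [hf' 5 (by decide), h5₁]
    by_cases hb : betterExpr.eval s' = 0
    · have hex : selectStep.exec s' = s' := by simp [selectStep, Program.exec, hb]
      refine hps _ _ _ hs' (by rwa [hex]) ?_
      rw [hex]
      have hb' : s' 6 k = 0 →
          ServedBefore (s' 5 (s' 11 0)) (s' 1 (s' 11 0)) (s' 5 k) (s' 1 k) := by
        rw [← not_not (a := _ = 0), ← Ne, betterExpr_eval_ne_zero, h9, not_and, not_not] at hb
        exact hb
      rw [hB'.req_eq, hB'.req_eq] at hb'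
      rcases hi with ⟨h1, h2⟩ | ⟨h1, h2, h3⟩
      · refine Or.inl ⟨h1, fun c hc => ?_⟩
        rcases Nat.lt_succ_iff_lt_or_eq.1 hc with hc | rfl
        · exact h2 c hc
        · intro h0
          have h4 := hb' h0
          have := input_one_pos (I := I) hk
          rw [h1, h5', input_one_buyers] at h4
          unfold ServedBefore at h4
          omega
      · refine Or.inr ⟨h1, h2, fun c hc => ?_⟩
        rcases Nat.lt_succ_iff_lt_or_eq.1 hc with hc | rfl
        · exact h3 c hc
        · exact hb'
    · have hex : selectStep.exec s' = s'.write 11 0 k := by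
        simp [selectStep, Program.exec, hb, Expr.eval, h9]
      refine hps _ _ _ hs' (by rw [hex]; exact hs'.write (by omega)) ?_
      rw [hex]
      obtain ⟨hb1, hb2⟩ := betterExpr_eval_ne_zero.1 hb
      rw [h9] at hb1 hb2
      rw [hB'.req_eq, hB'.req_eq] at hb2
      have hb3 := ServedBefore.total hb2
      refine Or.inr ?_
      simp only [Memory.write, and_self, if_true, Nat.reduceEqDiff, false_and,
        if_false]
      refine ⟨hk, hb1, fun c hc hc0 => ?_⟩
      rcases Nat.lt_succ_iff_lt_or_eq.1 hc with hc | rfl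
      · rcases hi with ⟨h1, h2⟩ | ⟨h1, h2, h3⟩
        · exact absurd hc0 (h2 c hc)
        · exact hb3.trans (h3 c hc hc0) (input_one_pos hk) (input_one_pos h1)
            (input_one_pos (hc.trans hk))
      · exact Or.inr ⟨rfl, le_rfl⟩
  · exact Or.inl ⟨h11, fun c hc => absurd hc (Nat.not_lt_zero c)⟩

end WaterMarket

/-! ### The search for alternating paths -/

namespace WaterMarket

open Ram Program Expr

/-- Unmark all buyers; only the cell for the unsold units is marked. -/
def resetMarks : Program :=
  .seq (.forLoop 9 buyersExpr (.assign 7 (.var 9) (.const 0)))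
    (.seq (.assign 7 buyersExpr (.const 1))
      (.seq (.assign 12 (.const 0) (.const 1)) (.assign 13 (.const 0) (.const 1))))

/-- Nonzero if and only if the buyer in variable `9` is unmarked and compatible with the unit in
variable `10`, which is unsold or owned by a marked buyer. -/
def markableExpr : Expr :=
  .mul (.sub (.const 1) (.get 7 (.var 9)))
    (.mul (.get 2 (.add (.mul (.var 10) buyersExpr) (.var 9))) (.get 7 (.get 4 (.var 10))))

/-- Mark the buyer in variable `9`, with the unit in variable `10` as the next unit. -/
def markBuyer : Program :=
  .seq (.assign 12 (.const 0) (.add (.var 12) (.const 1)))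
    (.seq (.assign 7 (.var 9) (.var 12))
      (.seq (.assign 8 (.var 9) (.var 10)) (.assign 13 (.const 0) (.const 1))))

/-- Go through all pairs of a buyer and a unit, and mark the buyer if possible. -/
def scan : Program :=
  .seq (.assign 13 (.const 0) (.const 0))
    (.forLoop 9 buyersExpr (.forLoop 10 unitsExpr (.cond markableExpr markBuyer .skip)))

/-- Mark all buyers from whom an alternating path leads to an unsold unit. -/
def search : Program := .seq resetMarks (.loop (.var 13) scan)

/-- The marked buyers have pointers to a next unit each, whose owner has a smaller rank, so that
following the pointers leads to an unsold unit. -/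
structure Marks (I : WaterMarket) (s : Memory) : Prop where
  rank_buyers : s 7 I.buyers = 1
  count : s 12 0 = ((Finset.range (I.buyers + 1)).filter fun c => s 7 c ≠ 0).card
  rank_le : ∀ c ≤ I.buyers, s 7 c ≤ s 12 0
  next : ∀ c < I.buyers, s 7 c ≠ 0 → I.Edge (s 8 c) c ∧ s 7 (s 4 (s 8 c)) ≠ 0 ∧
    s 7 (s 4 (s 8 c)) < s 7 c

/-- No pair of buyer `c` and a unit below `m` allows to mark `c`. -/
def SaturatedAt (I : WaterMarket) (s : Memory) (c m : ℕ) : Prop :=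
  ∀ w < m, I.Edge w c → s 7 (s 4 w) ≠ 0 → s 7 c ≠ 0

variable {I : WaterMarket} {s : Memory}

theorem Marks.count_le (h : I.Marks s) : s 12 0 ≤ I.buyers + 1 := by
  rw [h.count]
  exact (Finset.card_filter_le _ _).trans (by simp)

theorem Marks.congr {s' : Memory} (h : I.Marks s) (h4 : s' 4 = s 4) (h7 : s' 7 = s 7)
    (h8 : s' 8 = s 8) (h12 : s' 12 = s 12) : I.Marks s' := by
  constructor
  · rw [h7]; exact h.rank_buyers
  · rw [h7, h12]; exact h.count
  · rw [h7, h12]; exact h.rank_le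
  · rw [h4, h7, h8]; exact h.next

theorem exists_poly_resetMarks : ∃ p : Polynomial ℕ, ∀ (I : WaterMarket) (s : Memory),
    s.Bounded I.size → I.Base s →
      Halts I.size resetMarks s (p.eval I.size) fun s' => I.Marks s' ∧ s' 13 0 = 1 := by
  have hlf : (Program.assign 7 (.var 9) (.const 0)).LoopFree := trivial
  obtain ⟨pb, hpb⟩ := hlf.exists_poly_halts
  have hlf' : (Program.seq (.assign 7 buyersExpr (.const 1))
      (.seq (.assign 12 (.const 0) (.const 1)) (.assign 13 (.const 0) (.const 1)))).LoopFree :=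
    ⟨trivial, trivial, trivial⟩
  obtain ⟨pa, hpa⟩ := hlf'.exists_poly_halts
  obtain ⟨q, hq⟩ := exists_poly_forLoop 9 buyersExpr pb
  refine ⟨q + pa + 1, fun I s hs hB => ?_⟩
  rw [Polynomial.eval_add, Polynomial.eval_add, Polynomial.eval_one]
  refine Halts.seq (R := fun s' => ∀ c < I.buyers, s' 7 c = 0)
    (hq _ _ s I.buyers (fun k s' => ∀ c < k, s' 7 c = 0) (by decide) hs buyers_le_size
      ?_ ?_ ?_ ?_) ?_
  · intro s' hf'
    simp only [buyersExpr, Expr.eval, hf' 0 (by decide), hB.buyers_eq]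
  · intro k s' x h
    simpa [Memory.write] using h
  · intro k s' hk hs' hf' h9 hi
    refine hpb _ _ _ hs' (hs'.write (Nat.zero_le _)) fun c hc => ?_
    simp only [Program.exec, Expr.eval, h9, Memory.write, true_and]
    split_ifs with h
    · rfl
    · exact hi c (by omega)
  · exact fun c hc => absurd hc (Nat.not_lt_zero c)
  intro s₁ hs₁ hf₁ h7
  have hB₁ : I.Base s₁ := hB.of_frame fun a ha => hf₁ a (by
    simp [Program.forLoop, Program.writes]; omega)
  have h1 : 1 ≤ 2 ^ I.size := Nat.one_le_two_pow
  refine hpa _ _ _ hs₁ (((hs₁.write h1).write h1).write h1) ⟨?_, ?_⟩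
  · have e : buyersExpr.eval s₁ = I.buyers := hB₁.buyers_eq
    simp only [Program.exec, e]
    constructor
    · simp [Memory.write, Expr.eval]
    · have : ((Finset.range (I.buyers + 1)).filter fun c =>
          (if c = I.buyers then 1 else s₁ 7 c) ≠ 0) = {I.buyers} := by
        ext c
        simp only [Finset.mem_filter, Finset.mem_range, Finset.mem_singleton]
        constructor
        · rintro ⟨h2, h3⟩
          by_contra h4
          rw [if_neg h4] at h3
          exact h3 (h7 c (by omega))
        · rintro rfl
          simp
      simp [Memory.write, Expr.eval, this]
    · intro c hc
      simp only [Memory.write, Expr.eval, Nat.reduceEqDiff, false_and, if_false, true_and, if_true]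
      split_ifs with h
      · exact le_rfl
      · rw [h7 c (by omega)]
        exact Nat.zero_le _
    · intro c hc h
      simp [Memory.write, Expr.eval, hc.ne, h7 c hc] at h
  · simp [Program.exec, Memory.write, Expr.eval]

theorem markableExpr_eval_ne_zero (hB : I.Base s) {w c : ℕ} (hw : w < I.units)
    (hc : c < I.buyers) (h9 : s 9 0 = c) (h10 : s 10 0 = w) :
    markableExpr.eval s ≠ 0 ↔ s 7 c = 0 ∧ I.Edge w c ∧ s 7 (s 4 w) ≠ 0 := by
  rw [← hB.compat_ne_zero_iff hw hc]
  simp only [markableExpr, buyersExpr, Expr.eval, h9, h10, hB.buyers_eq, Ne, mul_eq_zero, not_or]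
  omega

theorem markBuyer_exec (s : Memory) : markBuyer.exec s =
    (((s.write 12 0 (s 12 0 + 1)).write 7 (s 9 0) (s 12 0 + 1)).write 8 (s 9 0) (s 10 0)).write
      13 0 1 := by
  simp [markBuyer, Program.exec, Expr.eval, Memory.write]

theorem Marks.exec_markBuyer (h : I.Marks s) (hown : ∀ w < I.units, s 4 w ≤ I.buyers) {w c : ℕ}
    (hw : w < I.units) (hc : c < I.buyers) (h9 : s 9 0 = c) (h10 : s 10 0 = w) (h0 : s 7 c = 0)
    (hE : I.Edge w c) (hr : s 7 (s 4 w) ≠ 0) : I.Marks (markBuyer.exec s) := by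
  have e7 : ∀ x, markBuyer.exec s 7 x = if x = c then s 12 0 + 1 else s 7 x := fun x => by
    rw [markBuyer_exec]; simp [Memory.write, h9]
  have e8 : ∀ x, markBuyer.exec s 8 x = if x = c then w else s 8 x := fun x => by
    rw [markBuyer_exec]; simp [Memory.write, h9, h10]
  have e4 : markBuyer.exec s 4 = s 4 := by
    funext x; rw [markBuyer_exec]; simp [Memory.write]
  have e12 : markBuyer.exec s 12 0 = s 12 0 + 1 := by rw [markBuyer_exec]; simp [Memory.write]
  constructor
  · rw [e7, if_neg hc.ne', h.rank_buyers]
  · rw [e12, h.count, ← Finset.card_insert_of_notMem (a := c) (by simp [h0])]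
    congr 1
    ext x
    simp only [Finset.mem_insert, Finset.mem_filter, Finset.mem_range, e7]
    by_cases hx : x = c
    · subst hx
      simp
      omega
    · simp [hx]
  · intro x hx
    rw [e7, e12]
    split_ifs
    · exact le_rfl
    · exact (h.rank_le x hx).trans (Nat.le_succ _)
  · intro x hx hx7
    rw [e4, e8]
    by_cases hxc : x = c
    · subst hxc
      rw [if_pos rfl]
      have hne : s 4 w ≠ x := fun h' => hr (h' ▸ h0)
      rw [e7, e7, if_neg hne, if_pos rfl]
      exact ⟨hE, hr, Nat.lt_succ_of_le (h.rank_le _ (hown w hw))⟩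
    · rw [if_neg hxc, e7 x, if_neg hxc]
      rw [e7, if_neg hxc] at hx7
      obtain ⟨h1, h2, h3⟩ := h.next x hx hx7
      have hne : s 4 (s 8 x) ≠ c := fun h' => h2 (h' ▸ h0)
      rw [e7, if_neg hne]
      exact ⟨h1, h2, h3⟩

/-- State of a scan that started with `K` marked cells and has dealt with the buyers below `k`. -/
structure Scanning (I : WaterMarket) (K k : ℕ) (s : Memory) : Prop where
  marks : I.Marks s
  changed_le : s 13 0 ≤ 1
  changed : K + s 13 0 ≤ s 12 0
  saturated : s 13 0 = 0 → ∀ c < k, I.SaturatedAt s c I.units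

theorem Scanning.write {K k : ℕ} (h : I.Scanning K k s) {v : ℕ} (hv : v = 9 ∨ v = 10) (x : ℕ) :
    I.Scanning K k (s.write v 0 x) := by
  have e : ∀ a, a ≠ 9 → a ≠ 10 → s.write v 0 x a = s a := by
    intro a h1 h2
    funext i
    have : a ≠ v := by omega
    simp [Memory.write, this]
  refine ⟨h.marks.congr ?_ ?_ ?_ ?_, ?_, ?_, ?_⟩
  any_goals exact e _ (by norm_num) (by norm_num)
  · rw [e 13 (by norm_num) (by norm_num)]; exact h.changed_le
  · rw [e 13 (by norm_num) (by norm_num), e 12 (by norm_num) (by norm_num)]; exact h.changed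
  · unfold SaturatedAt
    rw [e 13 (by norm_num) (by norm_num), e 7 (by norm_num) (by norm_num),
      e 4 (by norm_num) (by norm_num)]
    exact h.saturated

theorem SaturatedAt.write {c m v : ℕ} (h : I.SaturatedAt s c m) (hv : v = 9 ∨ v = 10) (x : ℕ) :
    I.SaturatedAt (s.write v 0 x) c m := by
  have e : ∀ a, a ≠ 9 → a ≠ 10 → s.write v 0 x a = s a := by
    intro a h1 h2
    funext i
    have : a ≠ v := by omega
    simp [Memory.write, this]
  unfold SaturatedAt
  rw [e 7 (by norm_num) (by norm_num), e 4 (by norm_num) (by norm_num)]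
  exact h

theorem exists_poly_scan : ∃ p : Polynomial ℕ, ∀ (I : WaterMarket) (s : Memory),
    s.Bounded I.size → I.Base s → (∀ w < I.units, s 4 w ≤ I.buyers) → I.Marks s →
      Halts I.size scan s (p.eval I.size) (I.Scanning (s 12 0) I.buyers) := by
  have hlf : (Program.cond markableExpr markBuyer .skip).LoopFree :=
    ⟨⟨trivial, trivial, trivial, trivial⟩, trivial⟩
  obtain ⟨pb, hpb⟩ := hlf.exists_poly_halts
  have hlf' : (Program.assign 13 (.const 0) (.const 0)).LoopFree := trivial
  obtain ⟨pa, hpa⟩ := hlf'.exists_poly_halts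
  obtain ⟨q, hq⟩ := exists_poly_forLoop 10 unitsExpr pb
  obtain ⟨q', hq'⟩ := exists_poly_forLoop 9 buyersExpr q
  refine ⟨pa + q' + 1, fun I s hs hB hown hM => ?_⟩
  rw [Polynomial.eval_add, Polynomial.eval_add, Polynomial.eval_one]
  have hn : I.buyers + 1 ≤ 2 ^ I.size :=
    (Nat.succ_le_succ buyers_le_size).trans Nat.lt_two_pow_self
  have hu : I.units ≤ 2 ^ I.size := units_le_size.trans Nat.lt_two_pow_self.le
  refine Halts.seq (R := I.Scanning (s 12 0) 0) (hpa _ _ _ hs (hs.write (Nat.zero_le _)) ?_) ?_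
  · refine ⟨hM.congr rfl rfl rfl rfl, ?_, ?_, fun _ c hc => absurd hc (Nat.not_lt_zero c)⟩ <;>
      simp [Program.exec, Expr.eval, Memory.write]
  intro s₁ hs₁ hf₁ hi₁
  have hB₁ : I.Base s₁ := hB.of_frame fun a ha => hf₁ a (by simp [Program.writes]; omega)
  have h4₁ : s₁ 4 = s 4 := hf₁ 4 (by decide)
  refine hq' _ _ s₁ I.buyers (I.Scanning (s 12 0)) (by decide) hs₁ buyers_le_size ?_
    (fun k s' x h => h.write (Or.inl rfl) x) ?_ hi₁
  · intro s' hf'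
    simp only [buyersExpr, Expr.eval, hf' 0 (by decide), hB₁.buyers_eq]
  intro c s₂ hc hs₂ hf₂ h9 hi₂
  have hB₂ : I.Base s₂ := hB₁.of_frame fun a ha => hf₂ a (by
    simp [Program.forLoop, Program.writes, markBuyer]; omega)
  have h4₂ : s₂ 4 = s 4 := by rw [hf₂ 4 (by decide), h4₁]
  refine Halts.mono (hq I.size (.cond markableExpr markBuyer .skip) s₂ I.units
    (fun m s' => I.Scanning (s 12 0) c s' ∧ (s' 13 0 = 0 → I.SaturatedAt s' c m))
    (by decide) hs₂ units_le_size ?_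
    (fun k s' x h => ⟨h.1.write (Or.inr rfl) x, fun h0 => (h.2 (by
      simpa [Memory.write] using h0)).write (Or.inr rfl) x⟩) ?_
    ⟨hi₂, fun _ w hw => absurd hw (Nat.not_lt_zero w)⟩) le_rfl ?_
  · intro s' hf'
    simp only [unitsExpr, Expr.eval, hf' 0 (by decide), hB₂.units_eq]
  · rintro w s₃ hw hs₃ hf₃ h10 ⟨hi₃, hsat⟩
    have hB₃ : I.Base s₃ := hB₂.of_frame fun a ha => hf₃ a (by
      simp [Program.writes, markBuyer]; omega)
    have h4₃ : s₃ 4 = s 4 := by rw [hf₃ 4 (by decide), h4₂]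
    have h9₃ : s₃ 9 0 = c := by rw [hf₃ 9 (by decide), h9]
    have hmk := markableExpr_eval_ne_zero hB₃ hw hc h9₃ h10
    by_cases hb : markableExpr.eval s₃ = 0
    · have hex : (Program.cond markableExpr markBuyer .skip).exec s₃ = s₃ := by
        simp [Program.exec, hb]
      refine hpb _ _ _ hs₃ (by rwa [hex]) ?_
      rw [hex]
      refine ⟨hi₃, fun h0 v hv hE hr => ?_⟩
      rcases Nat.lt_succ_iff_lt_or_eq.1 hv with hv | rfl
      · exact hsat h0 v hv hE hr
      · exact fun h7 => hmk.2 ⟨h7, hE, hr⟩ hb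
    · have hex : (Program.cond markableExpr markBuyer .skip).exec s₃ =
          markBuyer.exec s₃ := by
        simp [Program.exec, hb]
      obtain ⟨h7, hE, hr⟩ := hmk.1 hb
      have hM' : I.Marks (markBuyer.exec s₃) :=
        hi₃.marks.exec_markBuyer (by rwa [h4₃]) hw hc h9₃ h10 h7 hE hr
      have e12 : markBuyer.exec s₃ 12 0 = s₃ 12 0 + 1 := by
        rw [markBuyer_exec]; simp [Memory.write]
      have e13 : markBuyer.exec s₃ 13 0 = 1 := by
        rw [markBuyer_exec]; simp [Memory.write]
      have hle := hM'.count_le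
      rw [e12] at hle
      refine hpb _ _ _ hs₃ ?_ ?_
      · rw [hex, markBuyer_exec]
        exact (((hs₃.write (by omega)).write (by omega)).write (by omega)).write
          Nat.one_le_two_pow
      · rw [hex]
        have h1 := hi₃.changed
        refine ⟨⟨hM', ?_, ?_, ?_⟩, ?_⟩
        · rw [e13]
        · rw [e13, e12]; omega
        · rw [e13]; exact fun h => absurd h one_ne_zero
        · rw [e13]; exact fun h => absurd h one_ne_zero
  · rintro s' - - ⟨h1, h2⟩
    refine ⟨h1.marks, h1.changed_le, h1.changed, fun h0 d hd => ?_⟩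
    rcases Nat.lt_succ_iff_lt_or_eq.1 hd with hd | rfl
    · exact h1.saturated h0 d hd
    · exact h2 h0

theorem exists_poly_search : ∃ p : Polynomial ℕ, ∀ (I : WaterMarket) (s : Memory),
    s.Bounded I.size → I.Base s → (∀ w < I.units, s 4 w ≤ I.buyers) →
      Halts I.size search s (p.eval I.size) fun s' => I.Marks s' ∧
        ∀ c < I.buyers, I.SaturatedAt s' c I.units := by
  obtain ⟨pr, hpr⟩ := exists_poly_resetMarks
  obtain ⟨ps, hps⟩ := exists_poly_scan
  obtain ⟨pe, hpe⟩ := (Expr.var 13).exists_poly_cost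
  refine ⟨pr + ((Polynomial.X + 3) * (pe + ps + 1)) + 1, fun I s hs hB hown => ?_⟩
  simp only [Polynomial.eval_add, Polynomial.eval_mul, Polynomial.eval_one, Polynomial.eval_X,
    Polynomial.eval_ofNat]
  refine (hpr I s hs hB).seq fun s₁ hs₁ hf₁ ⟨hM₁, h13⟩ => ?_
  have hB₁ : I.Base s₁ := hB.of_frame fun a ha => hf₁ a (by
    simp [resetMarks, Program.forLoop, Program.writes]; omega)
  have h4₁ : s₁ 4 = s 4 := hf₁ 4 (by decide)
  have hle₁ := hM₁.count_le
  refine Halts.mono (Halts.loop (Inv := fun k s' => k = I.buyers + 1 - s' 12 0 + s' 13 0 ∧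
    I.Marks s' ∧ s' 13 0 ≤ 1 ∧ (s' 13 0 = 0 → ∀ c < I.buyers, I.SaturatedAt s' c I.units))
    (fun s hs => hpe _ s hs) (T := ps.eval I.size) ?_ hs₁
    ⟨rfl, hM₁, h13.le, fun h => by omega⟩) ?_ ?_
  · rintro k s₂ hs₂ hf₂ ⟨hk, hM₂, h13₂, -⟩ he
    have hB₂ : I.Base s₂ := hB₁.of_frame fun a ha => hf₂ a (by
      simp [scan, markBuyer, Program.forLoop, Program.writes]; omega)
    have h4₂ : s₂ 4 = s 4 := by rw [hf₂ 4 (by decide), h4₁]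
    refine (hps I s₂ hs₂ hB₂ (by rwa [h4₂]) hM₂).mono le_rfl fun s₃ _ _ h₃ => ?_
    -- The number of unmarked cells plus the flag decreases: a scan clears the flag, or it marks a
    -- buyer and so makes up for setting the flag again.
    refine ⟨_, ?_, rfl, h₃.marks, h₃.changed_le, h₃.saturated⟩
    have := h₃.changed
    have := h₃.marks.count_le
    simp only [Expr.eval] at he
    omega
  · have : I.buyers ≤ I.size := buyers_le_size
    exact Nat.mul_le_mul_right _ (by omega)
  · rintro s' - - ⟨he, k, -, hM, -, hsat⟩
    exact ⟨hM, hsat he⟩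

end WaterMarket

/-! ### Augmentation along an alternating path -/

namespace WaterMarket

open Ram Program Expr

/-- Give the buyer in variable `14` her next unit, and turn to the former owner of that unit. -/
def followStep : Program :=
  .seq (.assign 15 (.const 0) (.get 8 (.var 14)))
    (.seq (.assign 16 (.const 0) (.get 4 (.var 15)))
      (.seq (.assign 4 (.var 15) (.var 14)) (.assign 14 (.const 0) (.var 16))))

/-- Move the units along the path that starts at the selected buyer. -/
def follow : Program :=
  .seq (.assign 14 (.const 0) (.var 11)) (.loop (.sub buyersExpr (.var 14)) followStep)

/-- State on the way along a path that started at buyer `b` under the owner map `f`. The current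
buyer has been promised one unit more than she owns; the pointers that lie ahead are intact. -/
structure OnPath (I : WaterMarket) (f : ℕ → ℕ) (b : ℕ) (s : Memory) : Prop where
  cur_le : s 14 0 ≤ I.buyers
  edge : ∀ w < I.units, s 4 w = I.buyers ∨ I.Edge w (s 4 w)
  sold_eq : ∀ x, I.sold (s 4) x + (if x = s 14 0 then 1 else 0) =
    I.sold f x + if x = b then 1 else 0
  next : ∀ c < I.buyers, s 7 c ≠ 0 → s 7 c ≤ s 7 (s 14 0) → I.Edge (s 8 c) c ∧
    s 7 (s 4 (s 8 c)) ≠ 0 ∧ s 7 (s 4 (s 8 c)) < s 7 c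
  marked : s 7 (s 14 0) ≠ 0

variable {I : WaterMarket} {s : Memory}

theorem followStep_exec (s : Memory) : followStep.exec s =
    (((s.write 15 0 (s 8 (s 14 0))).write 16 0 (s 4 (s 8 (s 14 0)))).write 4 (s 8 (s 14 0))
      (s 14 0)).write 14 0 (s 4 (s 8 (s 14 0))) := by
  simp [followStep, Program.exec, Expr.eval, Memory.write]

theorem OnPath.exec_followStep {f : ℕ → ℕ} {b : ℕ} (h : I.OnPath f b s) (hlt : s 14 0 < I.buyers) :
    I.OnPath f b (followStep.exec s) ∧
      followStep.exec s 7 (followStep.exec s 14 0) < s 7 (s 14 0) := by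
  obtain ⟨hE, h0, hr⟩ := h.next _ hlt h.marked le_rfl
  obtain ⟨hw, -, -⟩ := id hE
  set w := s 8 (s 14 0) with hwdef
  have e7 : followStep.exec s 7 = s 7 := by
    funext x; rw [followStep_exec]; simp [Memory.write]
  have e8 : followStep.exec s 8 = s 8 := by
    funext x; rw [followStep_exec]; simp [Memory.write]
  have e14 : followStep.exec s 14 0 = s 4 w := by
    rw [followStep_exec]; simp [Memory.write, hwdef]
  have e4 : followStep.exec s 4 = Function.update (s 4) w (s 14 0) := by
    funext x
    rw [followStep_exec]
    simp [Memory.write, Function.update_apply, hwdef]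
  refine ⟨⟨?_, ?_, ?_, ?_, ?_⟩, by rwa [e7, e14]⟩
  · rw [e14]
    rcases h.edge w hw with h1 | ⟨_, h1, _⟩ <;> omega
  · intro v hv
    rw [e4, Function.update_apply]
    split_ifs with hvw
    · exact Or.inr (hvw ▸ hE)
    · exact h.edge v hv
  · intro x
    rw [e14, e4, ← h.sold_eq x]
    exact load_update _ (s 4) (Finset.mem_range.2 hw) _ x
  · intro c hc hc0 hcle
    rw [e7, e14] at hcle
    rw [e7] at hc0
    obtain ⟨h1, h2, h3⟩ := h.next c hc hc0 (by omega)
    -- The unit that has just changed hands is not a pointer ahead, as its owner had a larger rank.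
    have hne : s 8 c ≠ w := fun h' => by rw [h'] at h3; omega
    rw [e7, e8, e4, Function.update_of_ne hne]
    exact ⟨h1, h2, h3⟩
  · rwa [e7, e14]

theorem exists_poly_follow : ∃ p : Polynomial ℕ, ∀ (I : WaterMarket) (s : Memory),
    s.Bounded I.size → I.Base s → I.Marks s →
      (∀ w < I.units, s 4 w = I.buyers ∨ I.Edge w (s 4 w)) → s 11 0 < I.buyers →
      s 7 (s 11 0) ≠ 0 → Halts I.size follow s (p.eval I.size) fun s' =>
        (∀ w < I.units, s' 4 w = I.buyers ∨ I.Edge w (s' 4 w)) ∧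
        ∀ x, I.sold (s' 4) x + (if x = I.buyers then 1 else 0) =
          I.sold (s 4) x + if x = s 11 0 then 1 else 0 := by
  have hla : (Program.assign 14 (.const 0) (.var 11)).LoopFree := trivial
  obtain ⟨pa, hpa⟩ := hla.exists_poly_halts
  have hlf : followStep.LoopFree := ⟨trivial, trivial, trivial, trivial⟩
  obtain ⟨ps, hps⟩ := hlf.exists_poly_halts
  obtain ⟨pe, hpe⟩ := (Expr.sub buyersExpr (.var 14)).exists_poly_cost
  refine ⟨pa + (Polynomial.X + 2) * (pe + ps + 1) + 1, fun I s hs hB hM hE h11 h0 => ?_⟩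
  simp only [Polynomial.eval_add, Polynomial.eval_mul, Polynomial.eval_one, Polynomial.eval_X,
    Polynomial.eval_ofNat]
  refine Halts.seq (R := fun s' => s' 14 0 = s 11 0) (hpa _ _ _ hs (hs.write (hs _ _)) (by
    simp [Program.exec, Memory.write, Expr.eval])) fun s₁ hs₁ hf₁ h14 => ?_
  have hB₁ : I.Base s₁ := hB.of_frame fun a ha => hf₁ a (by simp [Program.writes]; omega)
  have h4₁ : s₁ 4 = s 4 := hf₁ 4 (by decide)
  have h7₁ : s₁ 7 = s 7 := hf₁ 7 (by decide)
  have h8₁ : s₁ 8 = s 8 := hf₁ 8 (by decide)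
  refine Halts.mono (Halts.loop (Inv := fun k s' => k = s' 7 (s' 14 0) ∧
    I.OnPath (s 4) (s 11 0) s') (fun s hs => hpe _ s hs) (T := ps.eval I.size) ?_ hs₁ ⟨rfl, ?_⟩)
    ?_ ?_
  · rintro k s₂ hs₂ hf₂ ⟨hk, hP⟩ he
    have hB₂ : I.Base s₂ := hB₁.of_frame fun a ha => hf₂ a (by
      simp [followStep, Program.writes]; omega)
    simp only [buyersExpr, Expr.eval, hB₂.buyers_eq] at he
    obtain ⟨h1, h2⟩ := hP.exec_followStep (by omega)
    refine hps _ _ _ hs₂ ?_ ⟨_, by rwa [hk], rfl, h1⟩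
    rw [followStep_exec]
    exact (((hs₂.write (hs₂ _ _)).write (hs₂ _ _)).write (hs₂ _ _)).write (hs₂ _ _)
  · refine ⟨?_, ?_, ?_, ?_, ?_⟩
    · rw [h14]; exact h11.le
    · rw [h4₁]; exact hE
    · rw [h4₁, h14]; exact fun _ => rfl
    · rw [h4₁, h7₁, h8₁]
      exact fun c hc hc0 _ => hM.next c hc hc0
    · rw [h7₁, h14]; exact h0
  · have h1 := hM.rank_le _ h11.le
    have h2 := hM.count_le
    have h3 : I.buyers ≤ I.size := buyers_le_size
    rw [h7₁, h14]
    exact Nat.mul_le_mul_right _ (by omega)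
  · rintro s' - hf' ⟨he, k, -, hP⟩
    have hB' : I.Base s' := hB₁.of_frame fun a ha => hf' a (by
      simp [followStep, Program.writes]; omega)
    simp only [buyersExpr, Expr.eval, hB'.buyers_eq] at he
    have hle := hP.cur_le
    have : s' 14 0 = I.buyers := by omega
    refine ⟨hP.edge, fun x => ?_⟩
    rw [← hP.sold_eq x, this]

/-! ### One round of the greedy algorithm -/

/-- Nonzero if and only if the selected buyer needs more units and is marked. -/
def augmentableExpr : Expr :=
  .mul (.sub (.get 1 (.var 11)) (.get 5 (.var 11))) (.get 7 (.var 11))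

/-- Give one more unit to the selected buyer, or close her if this is impossible. -/
def process : Program :=
  .seq search (.cond augmentableExpr
    (.seq follow (.assign 5 (.var 11) (.add (.get 5 (.var 11)) (.const 1))))
    (.assign 6 (.var 11) (.const 1)))

/-- The cost `exp (-l * (j / r))` of giving `j` units to buyer `b` with requirement `r`. -/
noncomputable def expCost (I : WaterMarket) (l : ℝ) (b j : ℕ) : ℝ :=
  Real.exp (-(l * (j / I.input 1 b : ℝ)))

/-- Invariant of the main loop. -/
structure Greedy (I : WaterMarket) (s : Memory) : Prop where
  base : I.Base s
  owner : I.IsOwnerMap (s 4)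
  sold_eq : ∀ c < I.buyers, s 5 c = I.sold (s 4) c
  sentinel : s 5 I.buyers = 1
  promising : ∀ᶠ l : ℝ in Filter.atTop, I.Promising (I.expCost l) (s 4) fun c => s 6 c ≠ 0

/-- Variant of the main loop: the number of open buyers plus the number of unsold units. -/
def remaining (I : WaterMarket) (s : Memory) : ℕ :=
  ((Finset.range I.buyers).filter fun c => s 6 c = 0).card + I.sold (s 4) I.buyers

theorem eventually_expCost_gain_le {f : ℕ → ℕ} {closed : ℕ → Prop} {b : ℕ} (hb : b < I.buyers)
    (hsel : ∀ c < I.buyers, ¬closed c →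
      ServedBefore (I.sold f b) (I.input 1 b) (I.sold f c) (I.input 1 c)) :
    ∀ᶠ l : ℝ in Filter.atTop, ∀ c < I.buyers, ¬closed c → ∀ j, I.sold f c ≤ j → j < I.units →
      I.expCost l c j - I.expCost l c (j + 1) ≤
        I.expCost l b (I.sold f b) - I.expCost l b (I.sold f b + 1) := by
  have h : ∀ c ∈ Finset.range I.buyers, ∀ j ∈ Finset.range I.units,
      ∀ᶠ l : ℝ in Filter.atTop, ¬closed c → I.sold f c ≤ j →
      I.expCost l c j - I.expCost l c (j + 1) ≤
        I.expCost l b (I.sold f b) - I.expCost l b (I.sold f b + 1) := by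
    intro c hc j _
    rw [Finset.mem_range] at hc
    by_cases hcl : closed c
    · exact Filter.Eventually.of_forall fun l h => absurd hcl h
    by_cases hj : I.sold f c ≤ j
    · have hpos := input_one_pos hb
      have hlift : ServedBefore (I.sold f b) (I.input 1 b) j (I.input 1 c) := by
        rcases hj.eq_or_lt with rfl | hlt
        · exact hsel c hc hcl
        · have h1 := Nat.mul_lt_mul_of_pos_right hlt hpos
          rcases hsel c hc hcl with h2 | ⟨h2, -⟩
          · exact Or.inl (h2.trans h1)
          · exact Or.inl (h2.trans_lt h1)
      filter_upwards [eventually_exp_gain_le (input_one_pos hc) hpos hlift] with l hl _ _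
      exact hl
    · exact Filter.Eventually.of_forall fun l _ h => absurd h hj
  simp_rw [← Filter.eventually_all_finset] at h
  filter_upwards [h] with l hl c hc hcl j hj hju
  exact hl c (Finset.mem_range.2 hc) j (Finset.mem_range.2 hju) hcl hj

theorem expCost_succ_le {l : ℝ} (hl : 0 ≤ l) (b j : ℕ) :
    I.expCost l b (j + 1) ≤ I.expCost l b j := by
  refine Real.exp_le_exp.2 (neg_le_neg (mul_le_mul_of_nonneg_left ?_ hl))
  exact div_le_div_of_nonneg_right (by push_cast; linarith) (Nat.cast_nonneg _)

theorem exists_poly_process : ∃ p : Polynomial ℕ, ∀ (I : WaterMarket) (s : Memory),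
    s.Bounded I.size → I.Greedy s → I.SelectedAmong I.buyers s → s 11 0 < I.buyers →
      Halts I.size process s (p.eval I.size) fun s' =>
        I.Greedy s' ∧ I.remaining s' < I.remaining s := by
  obtain ⟨p₁, hp₁⟩ := exists_poly_search
  obtain ⟨p₂, hp₂⟩ := exists_poly_follow
  obtain ⟨pe, hpe⟩ := augmentableExpr.exists_poly_cost
  have hli : (Program.assign 5 (.var 11) (.add (.get 5 (.var 11)) (.const 1))).LoopFree := trivial
  obtain ⟨p₃, hp₃⟩ := hli.exists_poly_halts
  have hlc : (Program.assign 6 (.var 11) (.const 1)).LoopFree := trivial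
  obtain ⟨p₄, hp₄⟩ := hlc.exists_poly_halts
  refine ⟨p₁ + (pe + (p₂ + p₃ + 1) + p₄ + 1) + 1, fun I s hs hG hS hlt => ?_⟩
  simp only [Polynomial.eval_add, Polynomial.eval_one]
  have hopen : s 6 (s 11 0) = 0 := by
    rcases hS with ⟨h, -⟩ | ⟨-, h, -⟩
    · omega
    · exact h
  have hsel : ∀ c < I.buyers, s 6 c = 0 →
      ServedBefore (s 5 (s 11 0)) (I.input 1 (s 11 0)) (s 5 c) (I.input 1 c) := by
    rcases hS with ⟨h, -⟩ | ⟨-, -, h⟩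
    · omega
    · exact h
  refine (hp₁ I s hs hG.base fun w hw => hG.owner.le_buyers hw).seq
    fun s₁ hs₁ hf₁ ⟨hM₁, hsat₁⟩ => ?_
  have hB₁ : I.Base s₁ := hG.base.of_frame fun a ha => hf₁ a (by
    simp [search, scan, resetMarks, markBuyer, Program.forLoop, Program.writes]; omega)
  have h4₁ : s₁ 4 = s 4 := hf₁ 4 (by decide)
  have h5₁ : s₁ 5 = s 5 := hf₁ 5 (by decide)
  have h6₁ : s₁ 6 = s 6 := hf₁ 6 (by decide)
  have h11₁ : s₁ 11 = s 11 := hf₁ 11 (by decide)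
  set b := s 11 0 with hb
  have h11b : s₁ 11 0 = b := by rw [h11₁]
  have hev : augmentableExpr.eval s₁ = (I.input 1 b - I.sold (s 4) b) * s₁ 7 b := by
    simp only [augmentableExpr, Expr.eval, h11b, hB₁.req_eq, h5₁, hG.sold_eq b hlt]
  refine Halts.cond (hpe _ _ hs₁) (fun he => ?_) (fun he => ?_)
  · rw [hev] at he
    have h7 : s₁ 7 b ≠ 0 := fun h => he (by rw [h, mul_zero])
    have hreq : I.sold (s 4) b < I.input 1 b := by
      by_contra h
      exact he (by rw [Nat.sub_eq_zero_of_le (not_lt.1 h), zero_mul])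
    refine (hp₂ I s₁ hs₁ hB₁ hM₁ (by rw [h4₁]; exact hG.owner.edge) (by rwa [h11b])
      (by rwa [h11b])).seq fun s₂ hs₂ hf₂ ⟨hE₂, hsold₂⟩ => ?_
    have hB₂ : I.Base s₂ := hB₁.of_frame fun a ha => hf₂ a (by
      simp [follow, followStep, Program.writes]; omega)
    have h5₂ : s₂ 5 = s 5 := by rw [hf₂ 5 (by decide), h5₁]
    have h6₂ : s₂ 6 = s 6 := by rw [hf₂ 6 (by decide), h6₁]
    have h11₂ : s₂ 11 0 = b := by rw [hf₂ 11 (by decide), h11b]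
    rw [h4₁, h11b] at hsold₂
    have hsold : ∀ x < I.buyers, I.sold (s₂ 4) x = I.sold (s 4) x + if x = b then 1 else 0 :=
      fun x hx => by
        have := hsold₂ x
        rwa [if_neg hx.ne] at this
    have haug : I.Augments (s 4) (s₂ 4) b := by
      refine ⟨⟨hE₂, fun x hx => ?_⟩, hsold⟩
      rw [hsold x hx]
      split_ifs with hxb
      · rw [hxb]; exact hreq
      · exact hG.owner.le_req x hx
    have hex : (Program.assign 5 (.var 11) (.add (.get 5 (.var 11)) (.const 1))).exec s₂ =
        s₂.write 5 b (s 5 b + 1) := by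
      simp [Program.exec, Expr.eval, h11₂, h5₂]
    have e : ∀ a, a ≠ 5 → s₂.write 5 b (s 5 b + 1) a = s₂ a := by
      intro a ha
      funext i
      simp [Memory.write, ha]
    have e5 : ∀ x, s₂.write 5 b (s 5 b + 1) 5 x = s 5 x + if x = b then 1 else 0 := by
      intro x
      simp only [Memory.write, true_and]
      split_ifs with h
      · rw [h]
      · rw [h5₂, add_zero]
    refine hp₃ _ _ _ hs₂ ?_ ?_
    · rw [hex]
      refine hs₂.write ?_
      rw [hG.sold_eq b hlt]
      have := hs₁ 1 b
      rw [hB₁.req_eq] at this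
      exact hreq.trans_le this
    rw [hex]
    refine ⟨⟨hB₂.of_frame fun a ha => e a (by omega), ?_, ?_, ?_, ?_⟩, ?_⟩
    · rw [e 4 (by norm_num)]; exact haug.1
    · intro c hc
      rw [e5, e 4 (by norm_num), hsold c hc, hG.sold_eq c hc]
    · rw [e5, if_neg hlt.ne', hG.sentinel]
    · rw [e 4 (by norm_num), e 6 (by norm_num), h6₂]
      have hev' := eventually_expCost_gain_le (f := s 4) (closed := fun c => s 6 c ≠ 0) hlt
        fun c hc hcl => by
          rw [← hG.sold_eq c hc, ← hG.sold_eq b hlt]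
          exact hsel c hc (not_not.1 hcl)
      filter_upwards [hG.promising, hev', Filter.eventually_ge_atTop 0] with l h1 h2 h3
      exact h1.augment hlt (not_not.2 hopen) haug (expCost_succ_le h3 _ _) h2
    · unfold remaining
      rw [e 4 (by norm_num), e 6 (by norm_num), h6₂]
      have := hsold₂ I.buyers
      rw [if_pos rfl, if_neg hlt.ne'] at this
      have h' : I.sold (s₂ 4) I.buyers + 1 = I.sold (s 4) I.buyers := this
      omega
  · rw [hev] at he
    have hno : ¬∃ f', I.Augments (s 4) f' b := by
      rcases mul_eq_zero.1 he with h | h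
      · rintro ⟨f', hf', hx⟩
        have h1 := hf'.le_req b hlt
        have h2 := hx b hlt
        rw [if_pos rfl] at h2
        omega
      · refine not_augments_of_saturated (marked := fun c => s₁ 7 c ≠ 0) hG.owner ?_ ?_ hlt
          (not_not.2 h)
        · rw [hM₁.rank_buyers]; exact one_ne_zero
        · rw [← h4₁]
          exact hsat₁
    have hex : (Program.assign 6 (.var 11) (.const 1)).exec s₁ = s₁.write 6 b 1 := by
      simp [Program.exec, Expr.eval, h11b]
    have e : ∀ a, a ≠ 6 → s₁.write 6 b 1 a = s₁ a := by
      intro a ha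
      funext i
      simp [Memory.write, ha]
    have e6 : ∀ x, s₁.write 6 b 1 6 x = if x = b then 1 else s 6 x := by
      intro x
      simp only [Memory.write, true_and, h6₁]
    refine hp₄ _ _ _ hs₁ (by rw [hex]; exact hs₁.write Nat.one_le_two_pow) ?_
    rw [hex]
    refine ⟨⟨hB₁.of_frame fun a ha => e a (by omega), ?_, ?_, ?_, ?_⟩, ?_⟩
    · rw [e 4 (by norm_num), h4₁]; exact hG.owner
    · rw [e 4 (by norm_num), h4₁, e 5 (by norm_num), h5₁]; exact hG.sold_eq
    · rw [e 5 (by norm_num), h5₁]; exact hG.sentinel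
    · rw [e 4 (by norm_num), h4₁]
      filter_upwards [hG.promising] with l hl
      convert hl.close hG.owner hlt hno using 2 with c
      rw [e6]
      by_cases hcb : c = b <;> simp [hcb]
    · unfold remaining
      rw [e 4 (by norm_num), h4₁]
      refine Nat.add_lt_add_right (Finset.card_lt_card
        (Finset.ssubset_iff_of_subset (fun c hc => ?_) |>.2 ⟨b, ?_, ?_⟩)) _
      · rw [Finset.mem_filter] at hc ⊢
        refine ⟨hc.1, ?_⟩
        have h1 := hc.2
        rw [e6] at h1
        split_ifs at h1
        exact h1
      · simp [hlt, hopen]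
      · simp [e6]

end WaterMarket

/-! ### The complete algorithm -/

namespace WaterMarket

open Ram Program Expr

/-- Mark all units as unsold, and write the sentinel that the selection of a buyer uses. -/
def init : Program :=
  .seq (.forLoop 10 unitsExpr (.assign 4 (.var 10) buyersExpr))
    (.assign 5 buyersExpr (.const 1))

/-- Enter the unit in variable `10` into the output matrix, if it is sold. -/
def writeStep : Program :=
  .cond (.sub buyersExpr (.get 4 (.var 10)))
    (.assign 3 (.add (.mul (.var 10) buyersExpr) (.get 4 (.var 10))) (.const 1)) .skip

/-- The greedy algorithm. -/
def greedyProgram : Program :=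
  .seq init (.seq select (.seq (.loop (.sub buyersExpr (.var 11)) (.seq process select))
    (.forLoop 10 unitsExpr writeStep)))

variable {I : WaterMarket} {s : Memory}

theorem input_bounded (I : WaterMarket) : I.input.Bounded I.size := by
  have hu : I.units ≤ 2 ^ I.size := units_le_size.trans Nat.lt_two_pow_self.le
  have hn : I.buyers ≤ 2 ^ I.size := buyers_le_size.trans Nat.lt_two_pow_self.le
  intro a i
  unfold input
  split
  · split_ifs
    exacts [hu, hn, Nat.zero_le _]
  · split_ifs with h
    · refine (Nat.lt_size_self _).le.trans (Nat.pow_le_pow_right (by norm_num) ?_)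
      have := Finset.single_le_sum (f := fun b => Nat.size (I.req b)) (fun _ _ => Nat.zero_le _)
        (Finset.mem_univ ⟨i, h⟩)
      unfold size
      omega
    · exact Nat.zero_le _
  · split_ifs
    exacts [Nat.one_le_two_pow, Nat.zero_le _]
  · exact Nat.zero_le _

theorem input_of_three_le {a : ℕ} (ha : 3 ≤ a) (i : ℕ) : I.input a i = 0 := by
  unfold input
  split <;> omega

theorem sold_eq_zero_of_unsold {f : ℕ → ℕ} (hf : ∀ w < I.units, f w = I.buyers) {c : ℕ}
    (hc : c < I.buyers) : I.sold f c = 0 := by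
  unfold sold load
  rw [Finset.card_eq_zero, Finset.filter_eq_empty_iff]
  intro w hw
  rw [hf w (Finset.mem_range.1 hw)]
  exact hc.ne'

theorem exists_poly_init : ∃ p : Polynomial ℕ, ∀ I : WaterMarket,
    Halts I.size init I.input (p.eval I.size) I.Greedy := by
  have hlf : (Program.assign 4 (.var 10) buyersExpr).LoopFree := trivial
  obtain ⟨pb, hpb⟩ := hlf.exists_poly_halts
  have hlf' : (Program.assign 5 buyersExpr (.const 1)).LoopFree := trivial
  obtain ⟨pa, hpa⟩ := hlf'.exists_poly_halts
  obtain ⟨q, hq⟩ := exists_poly_forLoop 10 unitsExpr pb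
  refine ⟨q + pa + 1, fun I => ?_⟩
  have hn : I.buyers ≤ 2 ^ I.size := buyers_le_size.trans Nat.lt_two_pow_self.le
  have hB : I.Base I.input := ⟨fun _ _ => rfl⟩
  rw [Polynomial.eval_add, Polynomial.eval_add, Polynomial.eval_one]
  refine Halts.seq (R := fun s' => ∀ w < I.units, s' 4 w = I.buyers)
    (hq _ _ _ I.units (fun k s' => ∀ w < k, s' 4 w = I.buyers) (by decide) I.input_bounded
      units_le_size ?_ ?_ ?_ ?_) ?_
  · intro s' hf'
    simp only [unitsExpr, Expr.eval, hf' 0 (by decide), hB.units_eq]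
  · intro k s' x h
    simpa [Memory.write] using h
  · intro k s' hk hs' hf' h10 hi
    have e : buyersExpr.eval s' = I.buyers := by
      simp only [buyersExpr, Expr.eval, hf' 0 (by decide), hB.buyers_eq]
    refine hpb _ _ _ hs' (hs'.write (by rwa [e])) fun c hc => ?_
    simp only [Program.exec, e, Expr.eval, h10, Memory.write, true_and]
    split_ifs with h
    · rfl
    · exact hi c (by omega)
  · exact fun c hc => absurd hc (Nat.not_lt_zero c)
  intro s₁ hs₁ hf₁ h4
  have hB₁ : I.Base s₁ := hB.of_frame fun a ha => hf₁ a (by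
    simp [Program.forLoop, Program.writes]; omega)
  have e : buyersExpr.eval s₁ = I.buyers := hB₁.buyers_eq
  have hex : (Program.assign 5 buyersExpr (.const 1)).exec s₁ = s₁.write 5 I.buyers 1 := by
    simp [Program.exec, e, Expr.eval]
  have e' : ∀ a, a ≠ 5 → s₁.write 5 I.buyers 1 a = s₁ a := by
    intro a ha
    funext i
    simp [Memory.write, ha]
  have h5 : ∀ i, s₁ 5 i = 0 := fun i => by
    rw [hf₁ 5 (by decide)]; exact input_of_three_le (by norm_num) i
  have h0 : ∀ c < I.buyers, I.sold (s₁ 4) c = 0 := fun c hc => sold_eq_zero_of_unsold h4 hc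
  refine hpa _ _ _ hs₁ (by rw [hex]; exact hs₁.write Nat.one_le_two_pow) ?_
  rw [hex]
  refine ⟨hB₁.of_frame fun a ha => e' a (by omega), ?_, ?_, ?_, ?_⟩
  · rw [e' 4 (by norm_num)]
    exact ⟨fun w hw => Or.inl (h4 w hw), fun c hc => by rw [h0 c hc]; exact Nat.zero_le _⟩
  · intro c hc
    rw [e' 4 (by norm_num), h0 c hc]
    simp [Memory.write, hc.ne, h5]
  · simp [Memory.write]
  · refine Filter.Eventually.of_forall fun l g hg => ⟨g, hg, le_rfl, fun c hc => ?_⟩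
    rw [e' 4 (by norm_num), e' 6 (by norm_num), h0 c hc, hf₁ 6 (by decide)]
    exact ⟨Nat.zero_le _, fun h => absurd (input_of_three_le (by norm_num) c) h⟩

theorem exists_poly_write : ∃ p : Polynomial ℕ, ∀ (I : WaterMarket) (s : Memory),
    s.Bounded I.size → I.Base s →
      Halts I.size (.forLoop 10 unitsExpr writeStep) s (p.eval I.size) fun s' => s' 4 = s 4 ∧
        ∀ i, s' 3 i ≠ 0 ↔ ∃ w < I.units, s 4 w < I.buyers ∧ i = w * I.buyers + s 4 w := by
  have hlf : writeStep.LoopFree := ⟨trivial, trivial⟩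
  obtain ⟨pb, hpb⟩ := hlf.exists_poly_halts
  obtain ⟨q, hq⟩ := exists_poly_forLoop 10 unitsExpr pb
  refine ⟨q, fun I s hs hB => ?_⟩
  refine (hq I.size writeStep s I.units (fun k s' => ∀ i, s' 3 i ≠ 0 ↔
    ∃ w < k, s 4 w < I.buyers ∧ i = w * I.buyers + s 4 w) (by decide) hs
      units_le_size ?_ ?_ ?_ ?_).mono le_rfl fun s' _ hf' h => ⟨hf' 4 (by decide), h⟩
  · intro s' hf'
    simp only [unitsExpr, Expr.eval, hf' 0 (by decide), hB.units_eq]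
  · intro k s' x h
    simpa [Memory.write] using h
  · intro k s' hk hs' hf' h10 hi
    have h4 : s' 4 = s 4 := hf' 4 (by decide)
    have e : s' 0 1 = I.buyers := by rw [hf' 0 (by decide), hB.buyers_eq]
    have hev : (Expr.sub buyersExpr (.get 4 (.var 10))).eval s' = I.buyers - s 4 k := by
      simp [buyersExpr, Expr.eval, e, h10, h4]
    by_cases hlt : s 4 k < I.buyers
    · have hex : writeStep.exec s' = s'.write 3 (k * I.buyers + s 4 k) 1 := by
        rw [writeStep, Program.exec, hev, if_pos (by omega)]
        simp [buyersExpr, Program.exec, Expr.eval, e, h10, h4]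
      refine hpb _ _ _ hs' (by rw [hex]; exact hs'.write Nat.one_le_two_pow) ?_
      rw [hex]
      intro i
      simp only [Memory.write, true_and]
      split_ifs with h
      · simp only [ne_eq, one_ne_zero, not_false_eq_true, true_iff]
        exact ⟨k, Nat.lt_succ_self k, hlt, h⟩
      · rw [hi i]
        constructor
        · rintro ⟨w, hw, h1⟩
          exact ⟨w, Nat.lt_succ_of_lt hw, h1⟩
        · rintro ⟨w, hw, h1, h2⟩
          rcases Nat.lt_succ_iff_lt_or_eq.1 hw with hw | rfl
          · exact ⟨w, hw, h1, h2⟩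
          · exact absurd h2 h
    · have hex : writeStep.exec s' = s' := by
        rw [writeStep, Program.exec, hev, if_neg (by omega), Program.exec]
      refine hpb _ _ _ hs' (by rwa [hex]) ?_
      rw [hex]
      intro i
      rw [hi i]
      constructor
      · rintro ⟨w, hw, h1⟩
        exact ⟨w, Nat.lt_succ_of_lt hw, h1⟩
      · rintro ⟨w, hw, h1, h2⟩
        rcases Nat.lt_succ_iff_lt_or_eq.1 hw with hw | rfl
        · exact ⟨w, hw, h1, h2⟩
        · exact absurd h1 hlt
  · intro i
    rw [hB.input_eq 3 (by norm_num), input_of_three_le (by norm_num)]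
    simp

theorem exists_poly_greedyProgram : ∃ p : Polynomial ℕ, ∀ I : WaterMarket,
    Halts I.size greedyProgram I.input (p.eval I.size) fun s' =>
      I.IsOwnerMap (s' 4) ∧
      (∀ᶠ l : ℝ in Filter.atTop, ∀ g, I.IsOwnerMap g →
        I.totalCost (I.expCost l) (s' 4) ≤ I.totalCost (I.expCost l) g) ∧
      ∀ i, s' 3 i ≠ 0 ↔ ∃ w < I.units, s' 4 w < I.buyers ∧ i = w * I.buyers + s' 4 w := by
  obtain ⟨p₁, hp₁⟩ := exists_poly_init
  obtain ⟨p₂, hp₂⟩ := exists_poly_select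
  obtain ⟨p₃, hp₃⟩ := exists_poly_process
  obtain ⟨p₄, hp₄⟩ := exists_poly_write
  obtain ⟨pe, hpe⟩ := (Expr.sub buyersExpr (.var 11)).exists_poly_cost
  refine ⟨p₁ + (p₂ + ((Polynomial.X + 1) * (pe + (p₃ + p₂ + 1) + 1) + p₄ + 1) + 1) + 1,
    fun I => ?_⟩
  simp only [Polynomial.eval_add, Polynomial.eval_mul, Polynomial.eval_one, Polynomial.eval_X]
  -- Selecting a buyer writes only to the scalars `9` and `11`.
  have hselect : ∀ s s' : Memory, (∀ a ∉ select.writes, s' a = s a) → I.Greedy s →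
      I.Greedy s' ∧ I.remaining s' = I.remaining s := by
    intro s s' hf hG
    have h4 : s' 4 = s 4 := hf 4 (by decide)
    have h5 : s' 5 = s 5 := hf 5 (by decide)
    have h6 : s' 6 = s 6 := hf 6 (by decide)
    refine ⟨⟨hG.base.of_frame fun a ha => hf a ?_, ?_, ?_, ?_, ?_⟩, ?_⟩
    · simp [select, selectStep, Program.forLoop, Program.writes]; omega
    · rw [h4]; exact hG.owner
    · rw [h4, h5]; exact hG.sold_eq
    · rw [h5]; exact hG.sentinel
    · rw [h4, h6]; exact hG.promising
    · rw [remaining, remaining, h4, h6]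
  refine (hp₁ I).seq fun s₁ hs₁ hf₁ hG₁ => ?_
  refine (hp₂ I s₁ hs₁ hG₁.base hG₁.sentinel).seq fun s₂ hs₂ hf₂ hS₂ => ?_
  obtain ⟨hG₂, -⟩ := hselect s₁ s₂ hf₂ hG₁
  refine Halts.seq (R := fun s' => s' 11 0 = I.buyers ∧ I.Greedy s' ∧
    I.SelectedAmong I.buyers s') (Halts.mono (Halts.loop (Inv := fun k s' => k = I.remaining s' ∧
      I.Greedy s' ∧ I.SelectedAmong I.buyers s') (fun s hs => hpe _ s hs)
      (T := p₃.eval I.size + p₂.eval I.size + 1) ?_ hs₂ ⟨rfl, hG₂, hS₂⟩) ?_ ?_) ?_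
  · rintro k s₃ hs₃ hf₃ ⟨hk, hG₃, hS₃⟩ he
    simp only [buyersExpr, Expr.eval, hG₃.base.buyers_eq] at he
    refine (hp₃ I s₃ hs₃ hG₃ hS₃ (by omega)).seq fun s₄ hs₄ hf₄ ⟨hG₄, hlt⟩ => ?_
    refine (hp₂ I s₄ hs₄ hG₄.base hG₄.sentinel).mono le_rfl fun s₅ hs₅ hf₅ hS₅ => ?_
    obtain ⟨hG₅, hr⟩ := hselect s₄ s₅ hf₅ hG₄
    exact ⟨_, by rw [hr, hk]; exact hlt, rfl, hG₅, hS₅⟩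
  · have h1 : I.remaining s₂ ≤ I.buyers + I.units :=
      Nat.add_le_add ((Finset.card_filter_le _ _).trans (by simp)) (sold_le_units _ _)
    have h2 : I.buyers + I.units ≤ I.size := by unfold size; omega
    exact Nat.mul_le_mul_right _ (by omega)
  · rintro s' - - ⟨he, k, -, hG, hS⟩
    simp only [buyersExpr, Expr.eval, hG.base.buyers_eq] at he
    refine ⟨?_, hG, hS⟩
    rcases hS with ⟨h, -⟩ | ⟨h, -⟩ <;> omega
  · rintro s₆ hs₆ - ⟨h11, hG₆, hS₆⟩
    refine (hp₄ I s₆ hs₆ hG₆.base).mono le_rfl fun s' _ _ ⟨h4, h3⟩ => ?_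
    rw [h4]
    refine ⟨hG₆.owner, ?_, h3⟩
    have hclosed : ∀ c < I.buyers, s₆ 6 c ≠ 0 := by
      rcases hS₆ with ⟨-, h⟩ | ⟨h, -⟩
      · exact h
      · omega
    filter_upwards [hG₆.promising] with l hl g hg
    exact hl.cost_le hclosed hg

/-! ### Owner maps and trading assignments -/

theorem assigned_eq_sold {T : Finset (Fin I.units × Fin I.buyers)} {f : ℕ → ℕ}
    (h : ∀ w b, (w, b) ∈ T ↔ f w = (b : ℕ)) (b : Fin I.buyers) : I.assigned T b = I.sold f b := by
  unfold assigned sold load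
  refine Finset.card_bij (fun p _ => (p.1 : ℕ)) ?_ ?_ ?_
  · rintro ⟨w, c⟩ hp
    simp only [Finset.mem_filter] at hp
    obtain ⟨hp, rfl⟩ := hp
    simp [(h _ _).1 hp]
  · rintro ⟨w, c⟩ hp ⟨w', c'⟩ hp' heq
    simp only [Finset.mem_filter] at hp hp'
    exact Prod.ext (Fin.ext heq) (hp.2.trans hp'.2.symm)
  · intro w hw
    simp only [Finset.mem_filter, Finset.mem_range] at hw
    exact ⟨(⟨w, hw.1⟩, b), by simp [h, hw.2], rfl⟩

theorem input_one (b : Fin I.buyers) : I.input 1 b = I.req b := by simp [input]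

theorem IsOwnerMap.isTradingAssignment {T : Finset (Fin I.units × Fin I.buyers)} {f : ℕ → ℕ}
    (hf : I.IsOwnerMap f) (h : ∀ w b, (w, b) ∈ T ↔ f w = (b : ℕ)) : I.IsTradingAssignment T := by
  refine ⟨?_, ?_, ?_⟩
  · rintro ⟨w, b⟩ hp
    have h1 := (h w b).1 hp
    obtain ⟨_, _, h2⟩ := (hf.edge w w.2).resolve_left (by rw [h1]; exact b.2.ne)
    simpa [h1] using h2
  · rintro ⟨w, b⟩ hp ⟨w', b'⟩ hp' heq
    obtain rfl : w = w' := heq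
    exact Prod.ext rfl (Fin.ext (((h w b).1 hp).symm.trans ((h w b').1 hp')))
  · intro b
    rw [assigned_eq_sold h, ← input_one]
    exact hf.le_req b b.2

theorem IsTradingAssignment.exists_isOwnerMap {T : Finset (Fin I.units × Fin I.buyers)}
    (hT : I.IsTradingAssignment T) :
    ∃ f, I.IsOwnerMap f ∧ ∀ w b, (w, b) ∈ T ↔ f w = (b : ℕ) := by
  classical
  have hex : ∀ w : ℕ, ∃ v : ℕ, ∀ hw : w < I.units,
      (v = I.buyers ∨ ∃ b, (⟨w, hw⟩, b) ∈ T ∧ v = (b : ℕ)) ∧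
        ∀ b, (⟨w, hw⟩, b) ∈ T → v = (b : ℕ) := by
    intro w
    by_cases hw : w < I.units
    · by_cases hb : ∃ b, ((⟨w, hw⟩ : Fin I.units), b) ∈ T
      · obtain ⟨b, hb⟩ := hb
        exact ⟨b, fun _ => ⟨Or.inr ⟨b, hb, rfl⟩, fun b' hb' =>
          congrArg (fun p => (p.2 : ℕ)) (hT.unit_once _ hb _ hb' rfl)⟩⟩
      · exact ⟨I.buyers, fun _ => ⟨Or.inl rfl, fun b h => absurd ⟨b, h⟩ hb⟩⟩
    · exact ⟨0, fun h => absurd h hw⟩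
  choose f hf using hex
  have hmem : ∀ (w : Fin I.units) (b : Fin I.buyers), (w, b) ∈ T ↔ f w = (b : ℕ) := by
    intro w b
    refine ⟨(hf w w.2).2 b, fun h => ?_⟩
    rcases (hf w w.2).1 with h1 | ⟨b', hb', h1⟩
    · have := b.2
      omega
    · have : b = b' := Fin.ext (h.symm.trans h1)
      rw [this]
      exact hb'
  refine ⟨f, ⟨fun w hw => ?_, fun b hb => ?_⟩, hmem⟩
  · refine (hf w hw).1.imp_right ?_
    rintro ⟨b, hb, h1⟩
    rw [h1]
    exact ⟨hw, b.2, hT.compat _ hb⟩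
  · rw [← assigned_eq_sold hmem ⟨b, hb⟩]
    exact (hT.le_req ⟨b, hb⟩).trans_eq (input_one ⟨b, hb⟩).symm

theorem totalCost_expCost {T : Finset (Fin I.units × Fin I.buyers)} {f : ℕ → ℕ}
    (h : ∀ w b, (w, b) ∈ T ↔ f w = (b : ℕ)) (l : ℝ) :
    I.totalCost (I.expCost l) f = ∑ b, Real.exp (-(l * I.satisfaction T b)) := by
  unfold totalCost
  rw [Finset.sum_range]
  refine Finset.sum_congr rfl fun b _ => ?_
  rw [expCost, satisfaction, assigned_eq_sold h, input_one]

theorem mem_output_iff {f : ℕ → ℕ}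
    (h : ∀ i, s 3 i ≠ 0 ↔ ∃ w < I.units, f w < I.buyers ∧ i = w * I.buyers + f w)
    (w : Fin I.units) (b : Fin I.buyers) : (w, b) ∈ I.output s ↔ f w = (b : ℕ) := by
  simp only [output, Finset.mem_filter, Finset.mem_univ, true_and]
  rw [h]
  constructor
  · rintro ⟨v, hv, hlt, heq⟩
    have h1 : (w : ℕ) = v := by
      have h2 := congrArg (· / I.buyers) heq
      have hpos : 0 < I.buyers := by omega
      simpa [Nat.add_comm (_ * _), Nat.add_mul_div_right _ _ hpos, Nat.div_eq_of_lt b.2,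
        Nat.div_eq_of_lt hlt] using h2
    subst h1
    omega
  · intro h1
    exact ⟨w, w.2, by rw [h1]; exact b.2, by rw [h1]⟩

end WaterMarket

/-- One program, on every instance, halts within time polynomial in the size of the instance and
leaves a trading assignment with leximin-largest buyer satisfaction vector in the memory. -/
theorem theorem4 :
    ∃ (prog : Ram.Program) (p : Polynomial ℕ), ∀ I : WaterMarket,
      ∃ (t : ℕ) (s : Ram.Memory),
        Ram.Run prog I.input t s ∧ t ≤ p.eval I.size ∧ I.IsLeximinLargest (I.output s) := by
  obtain ⟨p, hp⟩ := WaterMarket.exists_poly_greedyProgram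
  refine ⟨WaterMarket.greedyProgram, p, fun I => ?_⟩
  obtain ⟨t, s, hrun, ht, -, hf, hmin, hout⟩ := hp I
  have hmem := WaterMarket.mem_output_iff hout
  refine ⟨t, s, hrun, ht, hf.isTradingAssignment hmem, fun T' hT' => ?_⟩
  obtain ⟨g, hg, hgmem⟩ := hT'.exists_isOwnerMap
  refine leximinLarger_or_eq_of_sum_exp_le ?_
  filter_upwards [hmin] with l hl
  rw [← WaterMarket.totalCost_expCost hmem, ← WaterMarket.totalCost_expCost hgmem]
  exact hl g hg
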